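/- Let $s\in(0,1)$, let $N\in\mathbb N$ with $N>2s$, put $2^*_s=\frac{2N}{N-2s}$, let $\theta\in(1,2^*_s/2)$ and $\gamma\in(0,1)$, and let $\Omega\subset\mathbb R^N$ be a nonempty bounded open set. Let $$X_0=\{u\in H^s(\mathbb R^N):\ u=0\ \text{a.e. in }\mathbb R^N\setminus\Omega\},\qquad \langle u,v\rangle=\iint_{\mathbb R^{2N}}\frac{(u(x)-u(y))(v(x)-v(y))}{|x-y|^{N+2s}}\,dx\,dy,\qquad \|u\|=\langle u,u\rangle^{1/2},$$ write $u^+=\max\{u,0\}$, and for $\lambda>0$ and $u\in X_0$ put $$J_\lambda(u)=\frac1{2\theta}\|u\|^{2\theta}-\frac{\lambda}{1-\gamma}\int_\Omega(u^+)^{1-\gamma}\,dx-\frac1{2^*_s}\int_\Omega(u^+)^{2^*_s}\,dx .$$ A solution of the problem $$(P)\qquad \|u\|^{2(\theta-1)}(-\Delta)^su=\frac{\lambda}{u^\gamma}+u^{2^*_s-1}\ \text{ in }\Omega,\qquad u>0\ \text{ in }\Omega,\qquad u=0\ \text{ in }\mathbb R^N\setminus\Omega$$ is a function $u\in X_0$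 with $u>0$ a.e. in $\Omega$ such that, for every $\varphi\in X_0$, the functions $u^{-\gamma}\varphi$ and $u^{2^*_s-1}\varphi$ are integrable on $\Omega$ and $$\|u\|^{2(\theta-1)}\langle u,\varphi\rangle=\lambda\int_\Omega\frac{\varphi}{u^\gamma}\,dx+\int_\Omega u^{2^*_s-1}\varphi\,dx .$$ Call a triple $(\rho,\lambda_0,\alpha)$ with $\rho\in(0,1]$, $\lambda_0>0$, $\alpha>0$ admissible if $J_\lambda(u)\ge\alpha$ for all $\lambda\in(0,\lambda_0]$ and all $u\in X_0$ with $\|u\|=\rho$. Then admissible triples exist, and for every admissible triple $(\rho,\lambda_0,\alpha)$ and every $\lambda\in(0,\lambda_0]$, problem $(P)$ has a solution $u_0\in X_0$ with $J_\lambda(u_0)<0$. -/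

import Mathlib

open MeasureTheory

noncomputable section

namespace FracKirchhoff

/-- The fractional critical Sobolev exponent `2N / (N - 2s)`. -/
def critExp (N : ℕ) (s : ℝ) : ℝ := 2 * (N : ℝ) / ((N : ℝ) - 2 * s)

variable {N : ℕ}

/-- The integrand `(u(x) - u(y)) (v(x) - v(y)) / |x - y| ^ (N + 2s)` on `ℝ^N × ℝ^N`. -/
def kernel (s : ℝ) (u v : EuclideanSpace ℝ (Fin N) → ℝ)
    (p : EuclideanSpace ℝ (Fin N) × EuclideanSpace ℝ (Fin N)) : ℝ :=
  (u p.1 - u p.2) * (v p.1 - v p.2) / ‖p.1 - p.2‖ ^ ((N : ℝ) + 2 * s)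

/-- The scalar product `⟨u, v⟩`, the double integral of `kernel s u v` over `ℝ^{2N}`.  For `u`, `v`
in `H^s(ℝ^N)` the integrand is integrable by the Cauchy-Schwarz inequality. -/
def form (s : ℝ) (u v : EuclideanSpace ℝ (Fin N) → ℝ) : ℝ :=
  ∫ p : EuclideanSpace ℝ (Fin N) × EuclideanSpace ℝ (Fin N), kernel s u v p

/-- The norm `‖u‖ = ⟨u, u⟩ ^ (1/2)` of `X₀` (the Gagliardo seminorm on `ℝ^N`). -/
def gnorm (s : ℝ) (u : EuclideanSpace ℝ (Fin N) → ℝ) : ℝ := √(form s u u)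

/-- `u ∈ H^s(ℝ^N)`: `u` is square integrable with finite Gagliardo seminorm. -/
structure MemHs (s : ℝ) (u : EuclideanSpace ℝ (Fin N) → ℝ) : Prop where
  memLp : MemLp u 2 volume
  integrable : Integrable (kernel s u u) volume

/-- `u ∈ X₀`: `u ∈ H^s(ℝ^N)` and `u = 0` almost everywhere outside `Ω`. -/
structure MemX0 (s : ℝ) (Ω : Set (EuclideanSpace ℝ (Fin N)))
    (u : EuclideanSpace ℝ (Fin N) → ℝ) : Prop where
  memHs : MemHs s u
  zero_outside : ∀ᵐ x ∂(volume.restrict Ωᶜ), u x = 0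

/-- The energy functional
`J_λ(u) = ‖u‖^{2θ} / (2θ) - λ / (1-γ) ∫_Ω (u⁺)^{1-γ} - (1/2*) ∫_Ω (u⁺)^{2*}`. -/
def energy (s θ γ : ℝ) (Ω : Set (EuclideanSpace ℝ (Fin N))) (lam : ℝ)
    (u : EuclideanSpace ℝ (Fin N) → ℝ) : ℝ :=
  1 / (2 * θ) * gnorm s u ^ (2 * θ)
    - lam / (1 - γ) * (∫ x in Ω, max (u x) 0 ^ (1 - γ))
    - 1 / critExp N s * (∫ x in Ω, max (u x) 0 ^ critExp N s)

/-- `u ∈ X₀` is a (positive, weak) solution of the singular critical Kirchhoff problem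
`‖u‖^{2(θ-1)} (-Δ)^s u = λ u^{-γ} + u^{2*-1}` and `u > 0` in `Ω`, `u = 0` outside `Ω`.
Both integrals over `Ω` in the weak formulation are required to converge.  Since `u > 0` almost
everywhere in `Ω`, no division by zero occurs in the singular term. -/
structure IsSolution (s θ γ : ℝ) (Ω : Set (EuclideanSpace ℝ (Fin N))) (lam : ℝ)
    (u : EuclideanSpace ℝ (Fin N) → ℝ) : Prop where
  memX0 : MemX0 s Ω u
  pos : ∀ᵐ x ∂(volume.restrict Ω), 0 < u x
  integrable_singular : ∀ φ, MemX0 s Ω φ →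
    IntegrableOn (fun x => φ x / max (u x) 0 ^ γ) Ω volume
  integrable_critical : ∀ φ, MemX0 s Ω φ →
    IntegrableOn (fun x => max (u x) 0 ^ (critExp N s - 1) * φ x) Ω volume
  weak : ∀ φ, MemX0 s Ω φ →
    gnorm s u ^ (2 * (θ - 1)) * form s u φ
      = lam * (∫ x in Ω, φ x / max (u x) 0 ^ γ)
        + ∫ x in Ω, max (u x) 0 ^ (critExp N s - 1) * φ x

/-- The geometric property that singles out the triples `(ρ, λ₀, α)`: `ρ ∈ (0,1]`, `λ₀ > 0`,
`α > 0`, and `J_λ ≥ α` on the sphere `‖u‖ = ρ` of `X₀` for every `λ ∈ (0, λ₀]`. -/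
structure Geometry (s θ γ : ℝ) (Ω : Set (EuclideanSpace ℝ (Fin N))) (ρ lam₀ α : ℝ) : Prop where
  rho_pos : 0 < ρ
  rho_le_one : ρ ≤ 1
  lam₀_pos : 0 < lam₀
  alpha_pos : 0 < α
  bound : ∀ lam : ℝ, 0 < lam → lam ≤ lam₀ →
    ∀ u, MemX0 s Ω u → gnorm s u = ρ → α ≤ energy s θ γ Ω lam u

end FracKirchhoff

end

noncomputable section

namespace FracKirchhoff

variable {N : ℕ} {s : ℝ} {Ω : Set (EuclideanSpace ℝ (Fin N))}
  {u v w : EuclideanSpace ℝ (Fin N) → ℝ}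

open Filter Topology

/-! ### The Gagliardo form -/

/-! The solution is a minimizer of `J_λ` over the closed ball `‖u‖ ≤ ρ` of `X₀`. Near the origin the
term of order `1 - γ < 1` dominates, so the infimum is negative; since `J_λ ≥ α > 0` on the sphere,
a minimizer lies inside. Admissible triples exist because `2θ < p`, where `p = 2*_s`: by the Sobolev
inequality a small `ρ` beats the critical term, and then a small `λ₀` beats the singular one.

The difficulty is existence, the embedding into `L^p` not being compact. A minimizing sequence may
be taken nonnegative, and by `exists_subseq_tendsto_L2` a subsequence is `f n = u + w n` with `w n →
0` in `L²` and a.e. The singular term converges, and `brezis_lieb` splits both `‖f n‖²` and `∫ (f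
n)^p` into the parts of `u` and of `w n`. The bound on the sphere, extended by homogeneity
(`Geometry.critical_le`), reads `(1/p) ∫ |w|^p ≤ (1/2θ) ρ^(2θ-p) ‖w‖^p` for every `w` in `X₀`. If
`‖w n‖² → b`, then `‖u‖² + b ≤ ρ²`, so the critical mass carried by `w n` is worth at most `b^θ /
(2θ)`. The Kirchhoff term pays for it, because `(‖u‖²)^θ + b^θ ≤ (‖u‖² + b)^θ`. Hence `J_λ(u) ≤ lim
J_λ(f n)`, with no use of the best Sobolev constant.

The singular term is not differentiable where `u` vanishes, so only variations `u + tφ` with `φ ≥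
0`, `t > 0` are compared. They give `u > 0` a.e. (`IsBallMinimizer.ae_pos`) and then, by Fatou, a
supersolution inequality. The residual of the equation is thus a linear functional, nonnegative on
nonnegative functions, and it vanishes at `u` by scaling. Comparing `φ ≥ 0` with `ku + (φ - ku)⁺`
and letting `k → ∞` shows that it vanishes at `φ` (`IsBallMinimizer.residual_eq_zero`). -/

theorem kernel_self_nonneg (s : ℝ) (u : EuclideanSpace ℝ (Fin N) → ℝ)
    (p : EuclideanSpace ℝ (Fin N) × EuclideanSpace ℝ (Fin N)) : 0 ≤ kernel s u u p :=
  div_nonneg (mul_self_nonneg _) (Real.rpow_nonneg (norm_nonneg _) _)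

theorem kernel_comm (s : ℝ) (u v : EuclideanSpace ℝ (Fin N) → ℝ) :
    kernel s u v = kernel s v u := by
  funext p; simp only [kernel, mul_comm]

theorem kernel_comb (s : ℝ) (a b : ℝ) (u v w : EuclideanSpace ℝ (Fin N) → ℝ)
    (p : EuclideanSpace ℝ (Fin N) × EuclideanSpace ℝ (Fin N)) :
    kernel s u (fun x => a * v x + b * w x) p = a * kernel s u v p + b * kernel s u w p := by
  simp only [kernel]; ring

theorem aestronglyMeasurable_kernel (hu : AEStronglyMeasurable u volume)
    (hv : AEStronglyMeasurable v volume) : AEStronglyMeasurable (kernel s u v) volume := by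
  unfold kernel
  rw [Measure.volume_eq_prod]
  have hd : AEStronglyMeasurable
      (fun p : EuclideanSpace ℝ (Fin N) × EuclideanSpace ℝ (Fin N) =>
        ‖p.1 - p.2‖ ^ ((N : ℝ) + 2 * s)) (volume.prod volume) := by
    apply Measurable.aestronglyMeasurable
    fun_prop
  exact ((hu.comp_fst.sub hu.comp_snd).mul (hv.comp_fst.sub hv.comp_snd)).div₀ hd

theorem MemHs.integrable_kernel (hu : MemHs s u) (hv : MemHs s v) :
    Integrable (kernel s u v) volume := by
  refine (hu.integrable.add hv.integrable).mono'
    (aestronglyMeasurable_kernel hu.memLp.1 hv.memLp.1) (ae_of_all _ fun p => ?_)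
  simp only [kernel, Pi.add_apply, Real.norm_eq_abs]
  rw [abs_div, abs_of_nonneg (Real.rpow_nonneg (norm_nonneg (p.1 - p.2)) _), ← add_div]
  refine div_le_div_of_nonneg_right ?_ (Real.rpow_nonneg (norm_nonneg _) _)
  rw [abs_le]
  constructor <;>
    nlinarith [sq_nonneg (u p.1 - u p.2 + (v p.1 - v p.2)),
      sq_nonneg (u p.1 - u p.2 - (v p.1 - v p.2)), sq_nonneg (u p.1 - u p.2),
      sq_nonneg (v p.1 - v p.2)]

theorem MemHs.comb (hu : MemHs s u) (hv : MemHs s v) (a b : ℝ) :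
    MemHs s (fun x => a * u x + b * v x) where
  memLp := (hu.memLp.const_mul a).add (hv.memLp.const_mul b)
  integrable := by
    have h : kernel s (fun x => a * u x + b * v x) (fun x => a * u x + b * v x)
        = fun p => a * (a * kernel s u u p + b * kernel s u v p)
          + b * (a * kernel s u v p + b * kernel s v v p) := by
      funext p
      simp only [kernel]; ring
    rw [h]
    exact (((hu.integrable.const_mul a).add ((hu.integrable_kernel hv).const_mul b)).const_mul
      a).add ((((hu.integrable_kernel hv).const_mul a).add (hv.integrable.const_mul b)).const_mul b)

theorem MemX0.comb (hu : MemX0 s Ω u) (hv : MemX0 s Ω v) (a b : ℝ) :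
    MemX0 s Ω (fun x => a * u x + b * v x) where
  memHs := hu.memHs.comb hv.memHs a b
  zero_outside := by
    filter_upwards [hu.zero_outside, hv.zero_outside] with x h1 h2
    simp [h1, h2]

theorem MemX0.add_mul (hu : MemX0 s Ω u) (hv : MemX0 s Ω v) (t : ℝ) :
    MemX0 s Ω (fun x => u x + t * v x) := by
  simpa using hu.comb hv 1 t

theorem MemX0.sub (hu : MemX0 s Ω u) (hv : MemX0 s Ω v) :
    MemX0 s Ω (fun x => u x - v x) := by
  simpa [sub_eq_add_neg] using hu.comb hv 1 (-1)

theorem MemX0.const_mul (hu : MemX0 s Ω u) (t : ℝ) : MemX0 s Ω (fun x => t * u x) := by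
  simpa using hu.comb hu t 0

theorem form_comm (s : ℝ) (u v : EuclideanSpace ℝ (Fin N) → ℝ) : form s u v = form s v u := by
  rw [form, kernel_comm, form]

theorem form_self_nonneg (s : ℝ) (u : EuclideanSpace ℝ (Fin N) → ℝ) : 0 ≤ form s u u :=
  integral_nonneg (kernel_self_nonneg s u)

theorem gnorm_nonneg (s : ℝ) (u : EuclideanSpace ℝ (Fin N) → ℝ) : 0 ≤ gnorm s u :=
  Real.sqrt_nonneg _

theorem gnorm_sq (s : ℝ) (u : EuclideanSpace ℝ (Fin N) → ℝ) : gnorm s u ^ 2 = form s u u :=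
  Real.sq_sqrt (form_self_nonneg s u)

theorem gnorm_rpow (s : ℝ) (u : EuclideanSpace ℝ (Fin N) → ℝ) (t : ℝ) :
    gnorm s u ^ (2 * t) = form s u u ^ t := by
  rw [Real.rpow_mul (gnorm_nonneg s u), Real.rpow_two, gnorm_sq]

theorem MemHs.form_comb (hu : MemHs s u) (hv : MemHs s v) (hw : MemHs s w) (a b : ℝ) :
    form s u (fun x => a * v x + b * w x) = a * form s u v + b * form s u w := by
  simp only [form, kernel_comb]
  rw [integral_add ((hu.integrable_kernel hv).const_mul a)
    ((hu.integrable_kernel hw).const_mul b), integral_const_mul, integral_const_mul]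

theorem MemHs.form_self_comb (hu : MemHs s u) (hv : MemHs s v) (a b : ℝ) :
    form s (fun x => a * u x + b * v x) (fun x => a * u x + b * v x)
      = a ^ 2 * form s u u + 2 * a * b * form s u v + b ^ 2 * form s v v := by
  rw [(hu.comb hv a b).form_comb hu hv, form_comm s _ u, form_comm s _ v, hu.form_comb hu hv,
    hv.form_comb hu hv, form_comm s v u]
  ring

theorem MemHs.form_add_mul_self (hu : MemHs s u) (hv : MemHs s v) (t : ℝ) :
    form s (fun x => u x + t * v x) (fun x => u x + t * v x)
      = form s u u + 2 * t * form s u v + t ^ 2 * form s v v := by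
  simpa using hu.form_self_comb hv 1 t

theorem MemHs.form_sub_self_le (hu : MemHs s u) (hv : MemHs s v) :
    form s (fun x => u x - v x) (fun x => u x - v x) ≤ 2 * form s u u + 2 * form s v v := by
  have h1 := hu.form_self_comb hv 1 (-1)
  have h2 := hu.form_self_comb hv 1 1
  have h3 := form_self_nonneg s (fun x => 1 * u x + 1 * v x)
  simp only [one_mul, neg_mul, ← sub_eq_add_neg] at h1 h2 h3
  rw [h1]; nlinarith

/-- Expansion of `‖u/2 - v‖² ≥ 0`. The coefficient of `form s v v` is exactly 1 so that it cancels
against `MemHs.form_posPart_le` in the last step of the Euler-Lagrange argument. -/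
theorem MemHs.form_le (hu : MemHs s u) (hv : MemHs s v) :
    form s u v ≤ form s u u / 4 + form s v v := by
  have h1 := hu.form_self_comb hv (1 / 2) (-1)
  have h3 := form_self_nonneg s (fun x => 1 / 2 * u x + (-1) * v x)
  nlinarith

theorem form_const_mul_self (s t : ℝ) (u : EuclideanSpace ℝ (Fin N) → ℝ) :
    form s (fun x => t * u x) (fun x => t * u x) = t ^ 2 * form s u u := by
  simp only [form]
  rw [← integral_const_mul]
  congr 1; funext p; simp only [kernel]; ring

/-- Contractions shrink differences of values. This serves for positive parts, absolute values and
truncations alike. -/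
theorem kernel_comp_le {f : ℝ → ℝ} (hf : LipschitzWith 1 f) (s : ℝ)
    (u : EuclideanSpace ℝ (Fin N) → ℝ)
    (p : EuclideanSpace ℝ (Fin N) × EuclideanSpace ℝ (Fin N)) :
    kernel s (fun x => f (u x)) (fun x => f (u x)) p ≤ kernel s u u p := by
  refine div_le_div_of_nonneg_right ?_ (Real.rpow_nonneg (norm_nonneg _) _)
  have := hf.dist_le_mul (u p.1) (u p.2)
  rw [Real.dist_eq, Real.dist_eq, NNReal.coe_one, one_mul] at this
  rw [← abs_mul_abs_self, ← abs_mul_abs_self (u p.1 - u p.2)]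
  exact mul_self_le_mul_self (abs_nonneg _) this

theorem MemHs.comp (hu : MemHs s u) {f : ℝ → ℝ} (hf : LipschitzWith 1 f) (h0 : f 0 = 0) :
    MemHs s (fun x => f (u x)) where
  memLp := hf.comp_memLp h0 hu.memLp
  integrable := by
    have hm : AEStronglyMeasurable (fun x => f (u x)) volume :=
      hf.continuous.comp_aestronglyMeasurable hu.memLp.1
    refine hu.integrable.mono' (aestronglyMeasurable_kernel hm hm) (ae_of_all _ fun p => ?_)
    rw [Real.norm_of_nonneg (kernel_self_nonneg _ _ _)]
    exact kernel_comp_le hf s u p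

theorem MemX0.comp (hu : MemX0 s Ω u) {f : ℝ → ℝ} (hf : LipschitzWith 1 f) (h0 : f 0 = 0) :
    MemX0 s Ω (fun x => f (u x)) where
  memHs := hu.memHs.comp hf h0
  zero_outside := by
    filter_upwards [hu.zero_outside] with x h1
    rw [h1, h0]

theorem MemHs.form_comp_le (hu : MemHs s u) {f : ℝ → ℝ} (hf : LipschitzWith 1 f) (h0 : f 0 = 0) :
    form s (fun x => f (u x)) (fun x => f (u x)) ≤ form s u u :=
  integral_mono (hu.comp hf h0).integrable hu.integrable (kernel_comp_le hf s u)

theorem lipschitzWith_max_zero : LipschitzWith 1 (fun a : ℝ => max a 0) :=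
  LipschitzWith.id.max_const 0

theorem lipschitzWith_abs : LipschitzWith 1 (fun a : ℝ => |a|) :=
  LipschitzWith.of_dist_le_mul fun a b => by
    simpa [Real.dist_eq] using abs_abs_sub_abs_le_abs_sub a b

theorem lipschitzWith_clamp (k : ℝ) : LipschitzWith 1 (fun a : ℝ => max (min a k) (-k)) :=
  (LipschitzWith.id.min_const k).max_const (-k)

theorem MemX0.posPart (hu : MemX0 s Ω u) : MemX0 s Ω (fun x => max (u x) 0) :=
  hu.comp lipschitzWith_max_zero (max_self 0)

/-- Pointwise this is `(a⁺ - b⁺)² ≤ (a - b)(a⁺ - b⁺)`. -/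
theorem MemHs.form_posPart_le (hu : MemHs s u) :
    form s (fun x => max (u x) 0) (fun x => max (u x) 0) ≤ form s u (fun x => max (u x) 0) := by
  have hp := hu.comp lipschitzWith_max_zero (max_self 0)
  refine integral_mono hp.integrable (hu.integrable_kernel hp) fun p => ?_
  refine div_le_div_of_nonneg_right ?_ (Real.rpow_nonneg (norm_nonneg _) _)
  dsimp only
  rcases max_cases (u p.1) 0 with ⟨h1, h2⟩ | ⟨h1, h2⟩ <;>
  rcases max_cases (u p.2) 0 with ⟨h3, h4⟩ | ⟨h3, h4⟩ <;> rw [h1, h3] <;> nlinarith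

/-! ### The fractional Sobolev inequality -/

/-- Fatou's lemma for nonnegative integrable functions with bounded integrals. -/
theorem integrable_and_integral_le_of_tendsto {α : Type*} [MeasurableSpace α] {μ : Measure α}
    {f : ℕ → α → ℝ} {g : α → ℝ} {C : ℝ} (hf : ∀ n, Integrable (f n) μ)
    (h0 : ∀ n, ∀ᵐ x ∂μ, 0 ≤ f n x) (hC : ∀ n, ∫ x, f n x ∂μ ≤ C)
    (hlim : ∀ᵐ x ∂μ, Tendsto (fun n => f n x) atTop (𝓝 (g x))) :
    Integrable g μ ∧ ∫ x, g x ∂μ ≤ C := by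
  have hg0 : ∀ᵐ x ∂μ, 0 ≤ g x := by
    filter_upwards [hlim, ae_all_iff.2 h0] with x hx hx0
    exact ge_of_tendsto' hx hx0
  have hgm : AEStronglyMeasurable g μ :=
    aestronglyMeasurable_of_tendsto_ae atTop (fun n => (hf n).1) hlim
  have hC0 : 0 ≤ C := (integral_nonneg_of_ae (h0 0)).trans (hC 0)
  have hle : ∫⁻ x, ENNReal.ofReal (g x) ∂μ ≤ ENNReal.ofReal C := by
    calc ∫⁻ x, ENNReal.ofReal (g x) ∂μ
        = ∫⁻ x, liminf (fun n => ENNReal.ofReal (f n x)) atTop ∂μ := by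
          refine lintegral_congr_ae ?_
          filter_upwards [hlim] with x hx
          exact ((ENNReal.tendsto_ofReal hx).liminf_eq).symm
      _ ≤ liminf (fun n => ∫⁻ x, ENNReal.ofReal (f n x) ∂μ) atTop :=
          lintegral_liminf_le' fun n => (hf n).1.aemeasurable.ennreal_ofReal
      _ ≤ liminf (fun _ : ℕ => ENNReal.ofReal C) atTop := by
          refine liminf_le_liminf (Eventually.of_forall fun n => ?_)
          rw [← ofReal_integral_eq_lintegral_ofReal (hf n) (h0 n)]
          exact ENNReal.ofReal_le_ofReal (hC n)
      _ = ENNReal.ofReal C := liminf_const _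
  have hgi : Integrable g μ :=
    ⟨hgm, (hasFiniteIntegral_iff_ofReal hg0).2 (hle.trans_lt ENNReal.ofReal_lt_top)⟩
  refine ⟨hgi, ?_⟩
  rw [← ofReal_integral_eq_lintegral_ofReal hgi hg0] at hle
  exact (ENNReal.ofReal_le_ofReal_iff hC0).1 hle

theorem volume_real_ball (x : EuclideanSpace ℝ (Fin N)) {r : ℝ} (hr : 0 < r) :
    volume.real (Metric.ball x r)
      = r ^ (N : ℝ) * volume.real (Metric.ball (0 : EuclideanSpace ℝ (Fin N)) 1) := by
  rw [Measure.real, Measure.addHaar_ball_of_pos volume x hr, ENNReal.toReal_mul, Measure.real,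
    ENNReal.toReal_ofReal (by positivity), finrank_euclideanSpace_fin, Real.rpow_natCast]

theorem volume_real_ball_pos (x : EuclideanSpace ℝ (Fin N)) {r : ℝ} (hr : 0 < r) :
    0 < volume.real (Metric.ball x r) :=
  ENNReal.toReal_pos (Metric.measure_ball_pos volume x hr).ne' measure_ball_lt_top.ne

theorem sq_sub_le_mul_kernel (hs : 0 < s) {x y : EuclideanSpace ℝ (Fin N)} {r : ℝ}
    (hr : ‖x - y‖ ≤ r) :
    (u x - u y) ^ 2 ≤ r ^ ((N : ℝ) + 2 * s) * kernel s u u (x, y) := by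
  rcases eq_or_ne x y with rfl | hxy
  · simp [kernel]
  · have hpos : 0 < ‖x - y‖ := norm_pos_iff.2 (sub_ne_zero.2 hxy)
    simp only [kernel]
    rw [mul_div_assoc', le_div_iff₀ (Real.rpow_pos_of_pos hpos _), sq, mul_comm]
    exact mul_le_mul_of_nonneg_right
      (Real.rpow_le_rpow hpos.le hr (by positivity)) (mul_self_nonneg _)

theorem MemHs.integrable_fiber (hu : MemHs s u) :
    ∀ᵐ x, Integrable (fun y => kernel s u u (x, y)) volume := by
  have := hu.integrable
  rw [Measure.volume_eq_prod] at this
  exact this.prod_right_ae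

theorem MemHs.integrable_integral_fiber (hu : MemHs s u) :
    Integrable (fun x => ∫ y, kernel s u u (x, y)) volume := by
  have := hu.integrable
  rw [Measure.volume_eq_prod] at this
  exact this.integral_prod_left

theorem MemHs.integral_fiber (hu : MemHs s u) :
    ∫ x, ∫ y, kernel s u u (x, y) = form s u u := by
  have := hu.integrable
  rw [Measure.volume_eq_prod] at this
  rw [form, Measure.volume_eq_prod, integral_prod _ this]

theorem integral_fiber_nonneg (s : ℝ) (u : EuclideanSpace ℝ (Fin N) → ℝ)
    (x : EuclideanSpace ℝ (Fin N)) : 0 ≤ ∫ y, kernel s u u (x, y) :=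
  integral_nonneg fun _ => kernel_self_nonneg _ _ _

theorem setIntegral_sq_sub_le
    {x : EuclideanSpace ℝ (Fin N)} (hx : Integrable (fun y => kernel s u u (x, y)) volume)
    {r : ℝ} (hr : 0 < r) :
    ∫ y in Metric.ball x r, r ^ ((N : ℝ) + 2 * s) * kernel s u u (x, y)
      ≤ r ^ ((N : ℝ) + 2 * s) * ∫ y, kernel s u u (x, y) := by
  rw [integral_const_mul]
  refine mul_le_mul_of_nonneg_left ?_ (by positivity)
  exact setIntegral_le_integral hx (ae_of_all _ fun y => kernel_self_nonneg _ _ _)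

/-- The points `y` of the ball are of two kinds. If `|u y| ≤ |u x| / 2`, then `|u x - u y| ≥ |u x| /
2` and the kernel pays; the remaining points are counted by Chebyshev's inequality for `|u|^p`. -/
theorem sobolev_pointwise (hs : 0 < s) {p : ℝ} (hp : 0 < p)
    {x : EuclideanSpace ℝ (Fin N)} (hx : Integrable (fun y => kernel s u u (x, y)) volume)
    (hup : Integrable (fun y => |u y| ^ p) volume) (hux : u x ≠ 0) {r : ℝ} (hr : 0 < r) :
    u x ^ 2 / 4 * volume.real (Metric.ball x r)
      ≤ r ^ ((N : ℝ) + 2 * s) * (∫ y, kernel s u u (x, y))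
        + u x ^ 2 / 4 * ((2 / |u x|) ^ p * ∫ y, |u y| ^ p) := by
  have ha : 0 < |u x| := abs_pos.2 hux
  have hpt : ∀ y ∈ Metric.ball x r, u x ^ 2 / 4 ≤ r ^ ((N : ℝ) + 2 * s) * kernel s u u (x, y)
      + u x ^ 2 / 4 * ((2 / |u x|) ^ p * |u y| ^ p) := by
    intro y hy
    have h1 : (u x - u y) ^ 2 ≤ r ^ ((N : ℝ) + 2 * s) * kernel s u u (x, y) := by
      apply sq_sub_le_mul_kernel hs
      rw [← dist_eq_norm, dist_comm]; exact (Metric.mem_ball.1 hy).le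
    rcases le_or_gt |u y| (|u x| / 2) with h | h
    · have h2 : |u x| / 2 ≤ |u x - u y| := by
        have := abs_sub_abs_le_abs_sub (u x) (u y); linarith
      have h3 : u x ^ 2 / 4 ≤ (u x - u y) ^ 2 := by
        rw [← sq_abs (u x), ← sq_abs (u x - u y)]; nlinarith
      have : 0 ≤ u x ^ 2 / 4 * ((2 / |u x|) ^ p * |u y| ^ p) := by positivity
      linarith
    · have h2 : 1 ≤ (2 / |u x|) ^ p * |u y| ^ p := by
        rw [← Real.mul_rpow (by positivity) (abs_nonneg _)]
        refine Real.one_le_rpow ?_ hp.le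
        rw [div_mul_eq_mul_div, le_div_iff₀ ha]; linarith
      have : u x ^ 2 / 4 ≤ u x ^ 2 / 4 * ((2 / |u x|) ^ p * |u y| ^ p) :=
        le_mul_of_one_le_right (by positivity) h2
      nlinarith [sq_nonneg (u x - u y)]
  have hi1 : IntegrableOn (fun y => r ^ ((N : ℝ) + 2 * s) * kernel s u u (x, y))
      (Metric.ball x r) := (hx.const_mul _).integrableOn
  have hi2 : Integrable (fun y => u x ^ 2 / 4 * ((2 / |u x|) ^ p * |u y| ^ p)) :=
    (hup.const_mul _).const_mul _
  have hmain := setIntegral_mono_on (μ := volume) (s := Metric.ball x r)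
    (integrableOn_const measure_ball_lt_top.ne) (hi1.add hi2.integrableOn) measurableSet_ball hpt
  rw [setIntegral_const, smul_eq_mul, mul_comm] at hmain
  refine hmain.trans ?_
  simp only [Pi.add_apply]
  rw [integral_add hi1 hi2.integrableOn]
  refine add_le_add (setIntegral_sq_sub_le hx hr) ?_
  refine (setIntegral_le_integral hi2 (ae_of_all _ fun y => by positivity)).trans_eq ?_
  rw [integral_const_mul, integral_const_mul]

theorem critExp_pos (hs : 0 < s) (hN : 2 * s < N) : 0 < critExp N s :=
  div_pos (by linarith) (by linarith)

theorem two_lt_critExp (hs : 0 < s) (hN : 2 * s < N) : 2 < critExp N s := by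
  rw [critExp, lt_div_iff₀ (by linarith)]; linarith

/-- The form in which criticality is used: the factor `|u x|^(-p·2s/N)` produced by the choice of
radius turns a bound on `|u x|²` into one on `|u x|^p`. -/
theorem critExp_mul (hs : 0 < s) (hN : 2 * s < N) :
    critExp N s = 2 + critExp N s * (2 * s / N) := by
  have h1 : (N : ℝ) ≠ 0 := by linarith
  have h2 : (N : ℝ) - 2 * s ≠ 0 := by linarith
  rw [critExp]; field_simp; ring

/-- Pointwise form of the fractional Sobolev inequality. -/
theorem rpow_critExp_le (hs : 0 < s) (hN : 2 * s < N) {ω : ℝ}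
    (hω : ω = volume.real (Metric.ball (0 : EuclideanSpace ℝ (Fin N)) 1))
    {x : EuclideanSpace ℝ (Fin N)} (hx : Integrable (fun y => kernel s u u (x, y)) volume)
    (hup : Integrable (fun y => |u y| ^ critExp N s) volume)
    (hM : 0 < ∫ y, |u y| ^ critExp N s) :
    |u x| ^ critExp N s ≤ 8 / ω * (2 * 2 ^ critExp N s / ω) ^ (2 * s / N)
      * (∫ y, |u y| ^ critExp N s) ^ (2 * s / N) * ∫ y, kernel s u u (x, y) := by
  have hp := critExp_pos hs hN
  have hpe := critExp_mul hs hN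
  set p := critExp N s with hpdef
  set M := ∫ y, |u y| ^ p with hMdef
  set g := ∫ y, kernel s u u (x, y) with hgdef
  have hg0 : 0 ≤ g := integral_fiber_nonneg s u x
  have hω0 : 0 < ω := hω ▸ volume_real_ball_pos 0 one_pos
  have hNpos : (0 : ℝ) < N := by linarith
  rcases eq_or_ne (u x) 0 with h0 | h0
  · rw [h0, abs_zero, Real.zero_rpow hp.ne']; positivity
  have ha : 0 < |u x| := abs_pos.2 h0
  set a := |u x| with hadef
  -- With `r^N = T` the ball has twice the volume `(2/a)^p M` of the Chebyshev bound, so half of it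
  -- consists of points where `|u y| ≤ a/2`.
  set T := 2 * 2 ^ p / ω * M * a ^ (-p) with hT
  have hTpos : 0 < T := by positivity
  set r := T ^ (1 / (N : ℝ)) with hr
  have hrpos : 0 < r := by positivity
  have hrN : r ^ (N : ℝ) = T := by
    rw [hr, ← Real.rpow_mul hTpos.le, one_div_mul_cancel hNpos.ne', Real.rpow_one]
  have key := sobolev_pointwise hs hp hx hup h0 hrpos
  rw [volume_real_ball x hrpos, ← hω, Real.rpow_add hrpos, hrN, ← hgdef, ← hMdef, ← hadef,
    ← sq_abs (u x), ← hadef] at key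
  have h2a : (2 / a) ^ p * M = T * ω / 2 := by
    rw [Real.div_rpow zero_le_two ha.le, hT, Real.rpow_neg ha.le]
    field_simp
  rw [h2a] at key
  have h3 : a ^ 2 ≤ 8 / ω * (r ^ (2 * s) * g) := by
    have : T * (a ^ 2 * ω) ≤ T * (8 * (r ^ (2 * s) * g)) := by linarith
    have := le_of_mul_le_mul_left this hTpos
    rw [div_mul_eq_mul_div, le_div_iff₀ hω0]; exact this
  have hr2 : r ^ (2 * s)
      = (2 * 2 ^ p / ω) ^ (2 * s / N) * M ^ (2 * s / N) * a ^ (-(p * (2 * s / N))) := by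
    rw [hr, ← Real.rpow_mul hTpos.le, one_div_mul_eq_div, hT,
      Real.mul_rpow (by positivity) (by positivity), Real.mul_rpow (by positivity) (by positivity),
      ← Real.rpow_mul ha.le]
    congr 2; ring
  rw [hr2] at h3
  have h4 : a ^ p = a ^ 2 * a ^ (p * (2 * s / N)) := by
    rw [← Real.rpow_two, ← Real.rpow_add ha, ← hpe]
  have h5 : a ^ (-(p * (2 * s / N))) * a ^ (p * (2 * s / N)) = 1 := by
    rw [← Real.rpow_add ha, neg_add_cancel, Real.rpow_zero]
  rw [h4]
  calc a ^ 2 * a ^ (p * (2 * s / N))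
      ≤ 8 / ω * ((2 * 2 ^ p / ω) ^ (2 * s / N) * M ^ (2 * s / N) * a ^ (-(p * (2 * s / N))) * g)
        * a ^ (p * (2 * s / N)) := mul_le_mul_of_nonneg_right h3 (by positivity)
    _ = 8 / ω * (2 * 2 ^ p / ω) ^ (2 * s / N) * M ^ (2 * s / N) * g
        * (a ^ (-(p * (2 * s / N))) * a ^ (p * (2 * s / N))) := by ring
    _ = _ := by rw [h5, mul_one]

/-- Integrating the pointwise bound puts `M = ∫ |u|^p` on both sides, with exponent `2s/N < 1` on
the right, where it is absorbed. This needs `M` finite a priori, an assumption removed in `sobolev`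
by truncation. -/
theorem sobolev_of_integrable (hs : 0 < s) (hN : 2 * s < N) :
    ∃ S : ℝ, 0 < S ∧ ∀ u : EuclideanSpace ℝ (Fin N) → ℝ, MemHs s u →
      Integrable (fun y => |u y| ^ critExp N s) volume →
      ∫ y, |u y| ^ critExp N s ≤ S * form s u u ^ (critExp N s / 2) := by
  set ω := volume.real (Metric.ball (0 : EuclideanSpace ℝ (Fin N)) 1) with hω
  have hω0 : 0 < ω := volume_real_ball_pos 0 one_pos
  set C := 8 / ω * (2 * 2 ^ critExp N s / ω) ^ (2 * s / N) with hC
  have hCpos : 0 < C := by positivity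
  have hp := critExp_pos hs hN
  have hpe := critExp_mul hs hN
  refine ⟨C ^ (critExp N s / 2), by positivity, fun u hu hup => ?_⟩
  have hF := form_self_nonneg s u
  rw [← Real.mul_rpow hCpos.le hF]
  rcases (integral_nonneg fun y => Real.rpow_nonneg (abs_nonneg (u y)) _ :
    0 ≤ ∫ y, |u y| ^ critExp N s).eq_or_lt with h0 | hM
  · rw [← h0]; positivity
  set M := ∫ y, |u y| ^ critExp N s with hMdef
  have h1 : M ≤ C * M ^ (2 * s / N) * form s u u := by
    rw [← hu.integral_fiber, ← integral_const_mul]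
    refine integral_mono_ae hup (hu.integrable_integral_fiber.const_mul _) ?_
    filter_upwards [hu.integrable_fiber] with x hx
    exact rpow_critExp_le hs hN hω hx hup hM
  have h2 : M ^ (1 - 2 * s / N) ≤ C * form s u u := by
    rw [Real.rpow_sub hM, Real.rpow_one, div_le_iff₀ (by positivity)]
    linarith
  have h3 := Real.rpow_le_rpow (by positivity) h2 (by positivity : 0 ≤ critExp N s / 2)
  rwa [← Real.rpow_mul hM.le, show (1 - 2 * s / N) * (critExp N s / 2) = 1 by linarith,
    Real.rpow_one] at h3

/-- The fractional Sobolev inequality on `H^s(ℝ^N)`. -/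
theorem sobolev (hs : 0 < s) (hN : 2 * s < N) :
    ∃ S : ℝ, 0 < S ∧ ∀ u : EuclideanSpace ℝ (Fin N) → ℝ, MemHs s u →
      Integrable (fun y => |u y| ^ critExp N s) volume ∧
      ∫ y, |u y| ^ critExp N s ≤ S * form s u u ^ (critExp N s / 2) := by
  obtain ⟨S, hS, h⟩ := sobolev_of_integrable hs hN
  have hp := critExp_pos hs hN
  have hp2 := two_lt_critExp hs hN
  refine ⟨S, hS, fun u hu => ?_⟩
  -- Truncations are bounded and in `L²`, hence in `L^p`, and do not increase the form; Fatou's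
  -- lemma then passes to `u`.
  have hT : ∀ n : ℕ, MemHs s (fun x => max (min (u x) n) (-n)) := fun n =>
    hu.comp (lipschitzWith_clamp n) (by simp)
  have hTi : ∀ n : ℕ, Integrable (fun x => |max (min (u x) n) (-n)| ^ critExp N s) volume := by
    intro n
    have h2 := ((hT n).memLp.integrable_sq).const_mul ((n : ℝ) ^ (critExp N s - 2))
    refine h2.mono' ?_ (ae_of_all _ fun x => ?_)
    · exact ((hT n).memLp.1.norm.aemeasurable.pow_const _).aestronglyMeasurable
    · have hb : |max (min (u x) n) (-n)| ≤ (n : ℝ) := by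
        have : (0 : ℝ) ≤ n := n.cast_nonneg
        rw [abs_le]; constructor
        · exact le_max_right _ _
        · exact max_le (min_le_right _ _) (by linarith)
      set z := max (min (u x) n) (-(n : ℝ))
      rw [Real.norm_of_nonneg (by positivity)]
      rcases (abs_nonneg z).eq_or_lt with h0 | h0
      · rw [← h0, Real.zero_rpow hp.ne']; positivity
      · rw [← sq_abs z, ← Real.rpow_two,
          show critExp N s = (critExp N s - 2) + 2 by ring, Real.rpow_add h0]
        simp only [add_sub_cancel_right]
        exact mul_le_mul_of_nonneg_right (Real.rpow_le_rpow h0.le hb (by linarith)) (by positivity)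
  refine integrable_and_integral_le_of_tendsto hTi (fun n => ae_of_all _ fun x => by positivity)
    (fun n => (h _ (hT n) (hTi n)).trans ?_) (ae_of_all _ fun x => ?_)
  · refine mul_le_mul_of_nonneg_left (Real.rpow_le_rpow (form_self_nonneg _ _)
      (hu.form_comp_le (lipschitzWith_clamp n) (by simp)) (by positivity)) hS.le
  · refine tendsto_const_nhds.congr' ?_
    obtain ⟨k, hk⟩ := exists_nat_ge |u x|
    filter_upwards [eventually_ge_atTop k] with n hn
    have : |u x| ≤ n := hk.trans (by exact_mod_cast hn)
    rw [abs_le] at this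
    rw [min_eq_left this.2, max_eq_left this.1]

/-! ### A positive function in `X₀` -/

/-- Radial kernel dominating the Gagliardo quotient of a bounded Lipschitz function. -/
def truncKernel (s D : ℝ) (z : EuclideanSpace ℝ (Fin N)) : ℝ :=
  min (‖z‖ ^ 2) (D ^ 2) / ‖z‖ ^ ((N : ℝ) + 2 * s)

/-- In polar coordinates the radial integrand is at most `y^(1-2s)` near 0, integrable since `s <
1`, and `D² y^(-1-2s)` at infinity, integrable since `s > 0`. -/
theorem integrable_truncKernel (hs : 0 < s) (hs1 : s < 1) (hN : 0 < N) (D : ℝ) :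
    Integrable (truncKernel (N := N) s D) volume := by
  have : Nonempty (Fin N) := ⟨⟨0, hN⟩⟩
  have : Nontrivial (EuclideanSpace ℝ (Fin N)) := inferInstance
  have hmeas : AEStronglyMeasurable (fun y : ℝ => y ^ (N - 1) •
      (min (y ^ 2) (D ^ 2) / y ^ ((N : ℝ) + 2 * s))) volume := by
    apply Measurable.aestronglyMeasurable
    fun_prop
  refine (integrable_fun_norm_addHaar (E := EuclideanSpace ℝ (Fin N)) volume
    (f := fun y => min (y ^ 2) (D ^ 2) / y ^ ((N : ℝ) + 2 * s))).2 ?_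
  rw [finrank_euclideanSpace_fin, ← Set.Ioc_union_Ioi_eq_Ioi (zero_le_one (α := ℝ))]
  have hpow : ∀ y : ℝ, 0 < y → ∀ t : ℝ,
      y ^ (N - 1) * (y ^ t / y ^ ((N : ℝ) + 2 * s)) = y ^ (t - 1 - 2 * s) := by
    intro y hy t
    rw [← Real.rpow_natCast, Nat.cast_sub hN, ← Real.rpow_sub hy, ← Real.rpow_add hy]
    congr 1; push_cast; ring
  refine IntegrableOn.union ?_ ?_
  · have h1 : IntegrableOn (fun y : ℝ => y ^ (2 - 1 - 2 * s)) (Set.Ioc 0 1) :=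
      (intervalIntegrable_iff_integrableOn_Ioc_of_le zero_le_one).1
        (intervalIntegral.intervalIntegrable_rpow' (by linarith))
    refine h1.mono' hmeas.restrict ((ae_restrict_mem measurableSet_Ioc).mono fun y hy => ?_)
    have hy0 : 0 < y := hy.1
    rw [Real.norm_of_nonneg (by positivity), ← hpow y hy0 2, smul_eq_mul, Real.rpow_two]
    gcongr
    exact min_le_left _ _
  · have h1 : IntegrableOn (fun y : ℝ => D ^ 2 * y ^ (0 - 1 - 2 * s)) (Set.Ioi 1) :=
      (integrableOn_Ioi_rpow_of_lt (by linarith) one_pos).const_mul _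
    refine h1.mono' hmeas.restrict ((ae_restrict_mem measurableSet_Ioi).mono fun y hy => ?_)
    have hy0 : 0 < y := zero_lt_one.trans hy
    rw [Real.norm_of_nonneg (by positivity), ← hpow y hy0 0, smul_eq_mul, Real.rpow_zero,
      mul_left_comm, mul_one_div]
    gcongr
    exact min_le_right _ _

theorem integrable_indicator_mul_truncKernel (hs : 0 < s) (hs1 : s < 1) (hN : 0 < N) (D : ℝ)
    (hΩm : MeasurableSet Ω) (hΩf : volume Ω ≠ ⊤) :
    Integrable (fun p : EuclideanSpace ℝ (Fin N) × EuclideanSpace ℝ (Fin N) =>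
      Ω.indicator 1 p.2 * truncKernel s D (p.1 - p.2)) (volume.prod volume) := by
  have h1 : Integrable (Ω.indicator (1 : EuclideanSpace ℝ (Fin N) → ℝ)) volume :=
    (integrable_indicator_iff hΩm).2 (integrableOn_const hΩf)
  simpa using h1.convolution_integrand (ContinuousLinearMap.mul ℝ ℝ)
    (integrable_truncKernel hs hs1 hN D)

/-- The kernel vanishes unless one of the two points lies in `Ω`, and `|u x - u y| ≤ min(‖x - y‖,
2D)`. So it is dominated by `truncKernel` times the sum of the two indicators of `Ω`. -/
theorem memX0_of_lipschitz (hs : 0 < s) (hs1 : s < 1) (hN : 0 < N)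
    (hΩm : MeasurableSet Ω) (hΩf : volume Ω ≠ ⊤) (hu : LipschitzWith 1 u)
    (h0 : ∀ x ∉ Ω, u x = 0) {D : ℝ} (hD : ∀ x, |u x| ≤ D) : MemX0 s Ω u where
  zero_outside := (ae_restrict_mem hΩm.compl).mono h0
  memHs := by
    have hum : AEStronglyMeasurable u volume := hu.continuous.aestronglyMeasurable
    have hD0 : 0 ≤ D := (abs_nonneg _).trans (hD 0)
    refine ⟨?_, ?_⟩
    · rw [memLp_two_iff_integrable_sq hum]
      have h1 : Integrable (Ω.indicator (fun _ : EuclideanSpace ℝ (Fin N) => D ^ 2)) volume :=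
        (integrable_indicator_iff hΩm).2 (integrableOn_const hΩf)
      refine h1.mono' (hum.pow 2) (ae_of_all _ fun x => ?_)
      by_cases hx : x ∈ Ω
      · rw [Set.indicator_of_mem hx, Real.norm_of_nonneg (sq_nonneg _)]
        exact sq_le_sq' (neg_le_of_abs_le (hD x)) (le_of_abs_le (hD x))
      · simp [h0 x hx, Set.indicator_of_notMem hx]
    · have hi := integrable_indicator_mul_truncKernel hs hs1 hN (2 * D) hΩm hΩf
      have hi2 := hi.add hi.swap
      rw [← Measure.volume_eq_prod] at hi2
      refine hi2.mono' (aestronglyMeasurable_kernel hum hum) (ae_of_all _ fun p => ?_)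
      rw [Real.norm_of_nonneg (kernel_self_nonneg _ _ _)]
      have hsym : truncKernel s (2 * D) (p.2 - p.1) = truncKernel s (2 * D) (p.1 - p.2) := by
        simp only [truncKernel, norm_sub_rev]
      have ht0 : 0 ≤ truncKernel s (2 * D) (p.1 - p.2) := by
        unfold truncKernel; positivity
      have hind : ∀ x, 0 ≤ Ω.indicator (1 : EuclideanSpace ℝ (Fin N) → ℝ) x := fun x =>
        Set.indicator_nonneg (fun _ _ => zero_le_one) x
      simp only [Pi.add_apply, Function.comp_apply, Prod.fst_swap, Prod.snd_swap, hsym]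
      by_cases hx : p.1 ∉ Ω ∧ p.2 ∉ Ω
      · have : kernel s u u p = 0 := by simp [kernel, h0 _ hx.1, h0 _ hx.2]
        rw [this]
        exact add_nonneg (mul_nonneg (hind _) ht0) (mul_nonneg (hind _) ht0)
      · have h1 : 1 ≤ Ω.indicator (1 : EuclideanSpace ℝ (Fin N) → ℝ) p.2
            + Ω.indicator (1 : EuclideanSpace ℝ (Fin N) → ℝ) p.1 := by
          rcases not_and_or.1 hx with h | h
          · rw [Set.indicator_of_mem (not_not.1 h)]
            have := hind p.2
            simp only [Pi.one_apply]; linarith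
          · rw [Set.indicator_of_mem (not_not.1 h)]
            have := hind p.1
            simp only [Pi.one_apply]; linarith
        rw [← add_mul]
        refine le_trans ?_ (le_mul_of_one_le_left ht0 h1)
        refine div_le_div_of_nonneg_right ?_ (Real.rpow_nonneg (norm_nonneg _) _)
        have hl := hu.dist_le_mul p.1 p.2
        rw [Real.dist_eq, dist_eq_norm, NNReal.coe_one, one_mul] at hl
        have hb : |u p.1 - u p.2| ≤ 2 * D := by
          refine (abs_sub _ _).trans ?_
          linarith [hD p.1, hD p.2]
        rw [← sq, ← sq_abs]
        exact le_min (by gcongr) (by gcongr)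

/-- The distance to the complement of `Ω` serves; the complement is nonempty because `Ω` is bounded
and `N > 0`. -/
theorem exists_memX0_pos (hs : 0 < s) (hs1 : s < 1) (hN : 0 < N) (hΩo : IsOpen Ω)
    (hΩb : Bornology.IsBounded Ω) :
    ∃ φ : EuclideanSpace ℝ (Fin N) → ℝ, MemX0 s Ω φ ∧ (∀ x, 0 ≤ φ x) ∧ ∀ x ∈ Ω, 0 < φ x := by
  have : Nonempty (Fin N) := ⟨⟨0, hN⟩⟩
  have hne : Ωᶜ.Nonempty := by
    rw [Set.nonempty_compl]
    rintro rfl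
    exact NormedSpace.unbounded_univ ℝ (EuclideanSpace ℝ (Fin N)) hΩb
  obtain ⟨c, hc⟩ := hne
  obtain ⟨D, hD⟩ := hΩb.subset_closedBall c
  have h0 : ∀ x ∉ Ω, Metric.infDist x Ωᶜ = 0 := fun x hx => Metric.infDist_zero_of_mem hx
  refine ⟨fun x => Metric.infDist x Ωᶜ, ?_, fun x => Metric.infDist_nonneg, fun x hx => ?_⟩
  · refine memX0_of_lipschitz hs hs1 hN hΩo.measurableSet hΩb.measure_lt_top.ne
      (Metric.lipschitz_infDist_pt _) h0 (D := max D 0) fun x => ?_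
    rw [abs_of_nonneg Metric.infDist_nonneg]
    by_cases hx : x ∈ Ω
    · exact (Metric.infDist_le_dist_of_mem hc).trans
        ((Metric.mem_closedBall.1 (hD hx)).trans (le_max_left _ _))
    · rw [h0 x hx]; exact le_max_right _ _
  · exact (hΩo.isClosed_compl.notMem_iff_infDist_pos ⟨c, hc⟩).1 (not_not.2 hx)

/-! ### Integrability of the nonlinear terms and lower bounds for the energy -/

theorem rpow_le_one_add_rpow {a q p : ℝ} (ha : 0 ≤ a) (hq : 0 < q) (hqp : q ≤ p) :
    a ^ q ≤ 1 + a ^ p := by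
  rcases le_total a 1 with h | h
  · have := Real.rpow_le_one ha h hq.le
    have := Real.rpow_nonneg ha p
    linarith
  · have := Real.rpow_le_rpow_of_exponent_le h hqp
    linarith

theorem max_zero_le_abs (a : ℝ) : max a 0 ≤ |a| := max_le (le_abs_self a) (abs_nonneg a)

theorem MemHs.integrable_abs_rpow (hs : 0 < s) (hN : 2 * s < N) (hu : MemHs s u) :
    Integrable (fun x => |u x| ^ critExp N s) volume := by
  obtain ⟨S, -, h⟩ := sobolev (N := N) hs hN
  exact (h u hu).1

theorem MemHs.integrableOn_abs_rpow (hs : 0 < s) (hN : 2 * s < N) (hu : MemHs s u)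
    (hΩf : volume Ω ≠ ⊤) {q : ℝ} (hq : 0 < q) (hqp : q ≤ critExp N s) :
    IntegrableOn (fun x => |u x| ^ q) Ω := by
  refine ((integrableOn_const (C := (1 : ℝ)) hΩf).add
    (hu.integrable_abs_rpow hs hN).integrableOn).mono' ?_ (ae_of_all _ fun x => ?_)
  · exact (hu.memLp.1.norm.aemeasurable.pow_const _).aestronglyMeasurable.restrict
  · rw [Real.norm_of_nonneg (by positivity)]
    exact rpow_le_one_add_rpow (abs_nonneg _) hq hqp

theorem MemHs.integrableOn_posPart_rpow (hs : 0 < s) (hN : 2 * s < N) (hu : MemHs s u)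
    (hΩf : volume Ω ≠ ⊤) {q : ℝ} (hq : 0 < q) (hqp : q ≤ critExp N s) :
    IntegrableOn (fun x => max (u x) 0 ^ q) Ω := by
  have := (hu.comp lipschitzWith_max_zero (max_self 0)).integrableOn_abs_rpow hs hN hΩf hq hqp
  simpa only [abs_of_nonneg (le_max_right _ (0 : ℝ))] using this

theorem MemHs.setIntegral_posPart_rpow_critExp_le (hs : 0 < s) (hN : 2 * s < N) (hu : MemHs s u)
    (hΩf : volume Ω ≠ ⊤) :
    ∫ x in Ω, max (u x) 0 ^ critExp N s ≤ ∫ x, |u x| ^ critExp N s := by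
  have hp := critExp_pos hs hN
  refine (setIntegral_mono (hu.integrableOn_posPart_rpow hs hN hΩf hp le_rfl)
    (hu.integrable_abs_rpow hs hN).integrableOn fun x => ?_).trans
    (setIntegral_le_integral (hu.integrable_abs_rpow hs hN) (ae_of_all _ fun x => by positivity))
  exact Real.rpow_le_rpow (le_max_right _ _) (max_zero_le_abs _) hp.le

theorem MemHs.setIntegral_posPart_rpow_le (hs : 0 < s) (hN : 2 * s < N) (hu : MemHs s u)
    (hΩf : volume Ω ≠ ⊤) {q : ℝ} (hq : 0 < q) (hqp : q ≤ critExp N s) :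
    ∫ x in Ω, max (u x) 0 ^ q ≤ volume.real Ω + ∫ x, |u x| ^ critExp N s := by
  have hp := critExp_pos hs hN
  have hi := hu.integrableOn_posPart_rpow hs hN hΩf hp le_rfl
  have h1 : IntegrableOn (fun _ => (1 : ℝ)) Ω volume := integrableOn_const hΩf
  have := setIntegral_mono (hu.integrableOn_posPart_rpow hs hN hΩf hq hqp) (h1.add hi)
    fun x => rpow_le_one_add_rpow (le_max_right (u x) 0) hq hqp
  simp only [Pi.add_apply] at this
  rw [integral_add h1 hi] at this
  have h2 := hu.setIntegral_posPart_rpow_critExp_le hs hN hΩf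
  simp only [setIntegral_const, smul_eq_mul, mul_one] at this
  linarith

/-- Crude coercivity bound for the energy in terms of `F = ‖u‖²`. -/
theorem energy_lower_bound (hs : 0 < s) (hN : 2 * s < N) (hΩf : volume Ω ≠ ⊤) {γ : ℝ}
    (hγ₀ : 0 < γ) (hγ₁ : γ < 1) :
    ∃ S : ℝ, 0 < S ∧ ∀ (θ lam : ℝ) (u : EuclideanSpace ℝ (Fin N) → ℝ), 0 < lam → MemHs s u →
      1 / (2 * θ) * gnorm s u ^ (2 * θ)
        - lam / (1 - γ) * (volume.real Ω + S * gnorm s u ^ critExp N s)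
        - 1 / critExp N s * (S * gnorm s u ^ critExp N s) ≤ energy s θ γ Ω lam u := by
  obtain ⟨S, hS, h⟩ := sobolev (N := N) hs hN
  have hp := critExp_pos hs hN
  have hp2 := two_lt_critExp hs hN
  refine ⟨S, hS, fun θ lam u hlam hu => ?_⟩
  have h1 := (h u hu).2
  rw [← gnorm_rpow, mul_div_cancel₀ _ (two_ne_zero' ℝ)] at h1
  have h2 := hu.setIntegral_posPart_rpow_le hs hN hΩf (q := 1 - γ) (by linarith) (by linarith)
  have h3 := hu.setIntegral_posPart_rpow_critExp_le hs hN hΩf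
  unfold energy
  have h4 : 0 ≤ lam / (1 - γ) := div_nonneg hlam.le (by linarith)
  have h5 := mul_le_mul_of_nonneg_left (h2.trans (add_le_add_right h1 _)) h4
  have h6 := mul_le_mul_of_nonneg_left (h3.trans h1) (by positivity : 0 ≤ 1 / critExp N s)
  linarith

theorem exists_geometry (hs : 0 < s) (hN : 2 * s < N) (hΩf : volume Ω ≠ ⊤) {θ γ : ℝ}
    (hθ₁ : 1 < θ) (hθ₂ : θ < critExp N s / 2) (hγ₀ : 0 < γ) (hγ₁ : γ < 1) :
    ∃ ρ lam₀ α : ℝ, Geometry s θ γ Ω ρ lam₀ α := by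
  obtain ⟨S, hS, h⟩ := energy_lower_bound (N := N) (Ω := Ω) hs hN hΩf hγ₀ hγ₁
  have hp := critExp_pos hs hN
  set p := critExp N s with hpdef
  have hlim : Tendsto (fun r : ℝ => 1 / p * S * r ^ (p - 2 * θ)) (𝓝[>] 0) (𝓝 0) := by
    have h1 : ContinuousAt (fun r : ℝ => 1 / p * S * r ^ (p - 2 * θ)) 0 :=
      (Real.continuousAt_rpow_const 0 _ (Or.inr (by linarith))).const_mul _
    have h2 := h1.tendsto
    rw [Real.zero_rpow (by linarith), mul_zero] at h2
    exact h2.mono_left nhdsWithin_le_nhds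
  have hθp : 0 < 1 / (4 * θ) := by positivity
  obtain ⟨ρ, hρ, hρ0, hρ1⟩ := ((hlim.eventually (gt_mem_nhds hθp)).and
    (Ioc_mem_nhdsGT (zero_lt_one (α := ℝ)))).exists
  have hA : 0 < ρ ^ (2 * θ) := by positivity
  have h1 : 1 / p * (S * ρ ^ p) ≤ ρ ^ (2 * θ) / (4 * θ) := by
    have : ρ ^ p = ρ ^ (p - 2 * θ) * ρ ^ (2 * θ) := by rw [← Real.rpow_add hρ0]; congr 1; ring
    rw [this]
    calc 1 / p * (S * (ρ ^ (p - 2 * θ) * ρ ^ (2 * θ)))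
        = 1 / p * S * ρ ^ (p - 2 * θ) * ρ ^ (2 * θ) := by ring
      _ ≤ 1 / (4 * θ) * ρ ^ (2 * θ) := mul_le_mul_of_nonneg_right hρ.le hA.le
      _ = _ := by ring
  set K := volume.real Ω + S * ρ ^ p with hK
  have hKpos : 0 < K := by have : 0 ≤ volume.real Ω := measureReal_nonneg; positivity
  have h1γ : 0 < 1 - γ := by linarith
  -- In units of `ρ^(2θ)/(8θ)` the Kirchhoff term is 4, the critical part at most 2 by the choice of
  -- `ρ`, and the `λ` part at most 1 by the choice of `λ₀`; one unit is left for `α`.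
  refine ⟨ρ, (1 - γ) * (ρ ^ (2 * θ) / (8 * θ)) / K, ρ ^ (2 * θ) / (8 * θ), hρ0, hρ1,
    by positivity, by positivity, fun lam hlam hle u hu hun => ?_⟩
  have h2 := h θ lam u hlam hu.memHs
  rw [hun, ← hK] at h2
  refine le_trans ?_ h2
  have h3 : lam / (1 - γ) * K ≤ ρ ^ (2 * θ) / (8 * θ) := by
    rw [le_div_iff₀ hKpos] at hle
    rw [div_mul_eq_mul_div, div_le_iff₀ h1γ]; linarith
  have h4 : 1 / (2 * θ) * ρ ^ (2 * θ) = 4 * (ρ ^ (2 * θ) / (8 * θ)) := by field_simp; norm_num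
  have h5 : ρ ^ (2 * θ) / (4 * θ) = 2 * (ρ ^ (2 * θ) / (8 * θ)) := by field_simp; norm_num
  linarith

/-! ### The Brezis-Lieb lemma -/

/-- Convexity applied to `|a| + |b| = (1-t)(|a|/(1-t)) + t(|b|/t)`, with `t` so small that
`(1-t)^(1-p) < 1 + ε`. -/
theorem abs_add_rpow_le {p : ℝ} (hp : 1 < p) {ε : ℝ} (hε : 0 < ε) :
    ∃ C : ℝ, 0 < C ∧ ∀ a b : ℝ, |a + b| ^ p ≤ (1 + ε) * |a| ^ p + C * |b| ^ p := by
  have hlim : Tendsto (fun t : ℝ => (1 - t) ^ (1 - p)) (𝓝[>] 0) (𝓝 1) := by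
    have h1 : ContinuousAt (fun t : ℝ => (1 - t) ^ (1 - p)) 0 :=
      ContinuousAt.rpow_const (by fun_prop) (Or.inl (by norm_num))
    have h2 := h1.tendsto
    rw [sub_zero, Real.one_rpow] at h2
    exact h2.mono_left nhdsWithin_le_nhds
  obtain ⟨t, ht, ht0, ht1⟩ := ((hlim.eventually (gt_mem_nhds (lt_add_of_pos_right 1 hε))).and
    (Ioo_mem_nhdsGT (zero_lt_one (α := ℝ)))).exists
  have h1t : 0 < 1 - t := by linarith
  refine ⟨t ^ (1 - p), by positivity, fun a b => ?_⟩
  have hconv := (convexOn_rpow hp.le).2 (x := |a| / (1 - t)) (y := |b| / t)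
    (div_nonneg (abs_nonneg a) h1t.le) (div_nonneg (abs_nonneg b) ht0.le)
    h1t.le ht0.le (by ring)
  simp only [smul_eq_mul] at hconv
  rw [mul_div_cancel₀ _ h1t.ne', mul_div_cancel₀ _ ht0.ne', Real.div_rpow (abs_nonneg a) h1t.le,
    Real.div_rpow (abs_nonneg b) ht0.le] at hconv
  have e1 : (1 - t) * (|a| ^ p / (1 - t) ^ p) = (1 - t) ^ (1 - p) * |a| ^ p := by
    rw [Real.rpow_sub h1t, Real.rpow_one]; ring
  have e2 : t * (|b| ^ p / t ^ p) = t ^ (1 - p) * |b| ^ p := by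
    rw [Real.rpow_sub ht0, Real.rpow_one]; ring
  rw [e1, e2] at hconv
  calc |a + b| ^ p ≤ (|a| + |b|) ^ p :=
        Real.rpow_le_rpow (abs_nonneg _) (abs_add_le a b) (by linarith)
    _ ≤ _ := hconv
    _ ≤ _ := by
        refine add_le_add_left (mul_le_mul_of_nonneg_right ht.le (by positivity)) _

/-- The lower bound is the upper bound for the decomposition `a = (a + b) + (-b)`. -/
theorem abs_abs_add_rpow_sub_le {p : ℝ} (hp : 1 < p) {ε : ℝ} (hε : 0 < ε) :
    ∃ C : ℝ, 0 < C ∧ ∀ a b : ℝ, |(|a + b| ^ p - |a| ^ p)| ≤ ε * |a| ^ p + C * |b| ^ p := by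
  obtain ⟨C, hC, h⟩ := abs_add_rpow_le hp hε
  refine ⟨C, hC, fun a b => abs_le.2 ⟨?_, ?_⟩⟩
  · have h1 := h (a + b) (-b)
    rw [add_neg_cancel_right, abs_neg] at h1
    have h2 := h a b
    have h3 : 0 ≤ |a| ^ p := by positivity
    have h4 : 0 ≤ |b| ^ p := by positivity
    rcases le_total (|a + b| ^ p) (|a| ^ p) with h5 | h5
    · nlinarith
    · nlinarith
  · have := h a b; linarith

/-- The defect `D n` has no fixed integrable majorant, but after removal of `η |f n - g|^p` its
positive excess `H n` is at most `(C + 1)|g|^p` and dominated convergence applies. The removed part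
has integral at most `ηK'`. -/
theorem brezis_lieb {α : Type*} [MeasurableSpace α] {μ : Measure α} {p : ℝ} (hp : 1 < p)
    {f : ℕ → α → ℝ} {g : α → ℝ} {K : ℝ} (hm : ∀ n, AEStronglyMeasurable (f n) μ)
    (hi : ∀ n, Integrable (fun x => |f n x| ^ p) μ) (hK : ∀ n, ∫ x, |f n x| ^ p ∂μ ≤ K)
    (hlim : ∀ᵐ x ∂μ, Tendsto (fun n => f n x) atTop (𝓝 (g x))) :
    Tendsto (fun n => ∫ x, |f n x| ^ p ∂μ - ∫ x, |f n x - g x| ^ p ∂μ) atTop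
      (𝓝 (∫ x, |g x| ^ p ∂μ)) := by
  have hp0 : 0 < p := by linarith
  have hgm : AEStronglyMeasurable g μ := aestronglyMeasurable_of_tendsto_ae atTop hm hlim
  have hgi : Integrable (fun x => |g x| ^ p) μ := by
    refine (integrable_and_integral_le_of_tendsto hi (fun n => ae_of_all _ fun x => by positivity)
      hK ?_).1
    filter_upwards [hlim] with x hx
    exact hx.abs.rpow_const (Or.inr hp0.le)
  obtain ⟨C₁, hC₁, h₁⟩ := abs_add_rpow_le hp one_pos
  have hdm : ∀ n, AEStronglyMeasurable (fun x => |f n x - g x| ^ p) μ := fun n =>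
    (((hm n).sub hgm).norm.aemeasurable.pow_const _).aestronglyMeasurable
  have hdb : ∀ n x, |f n x - g x| ^ p ≤ (1 + 1) * |f n x| ^ p + C₁ * |g x| ^ p := fun n x => by
    have := h₁ (f n x) (-g x)
    rwa [abs_neg, ← sub_eq_add_neg] at this
  have hdi : ∀ n, Integrable (fun x => |f n x - g x| ^ p) μ := fun n =>
    (((hi n).const_mul _).add (hgi.const_mul _)).mono' (hdm n) (ae_of_all _ fun x => by
      rw [Real.norm_of_nonneg (by positivity)]; exact hdb n x)
  set K' := 2 * K + C₁ * ∫ x, |g x| ^ p ∂μ with hK'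
  have hdK : ∀ n, ∫ x, |f n x - g x| ^ p ∂μ ≤ K' := fun n => by
    have := integral_mono (hdi n) (((hi n).const_mul (1 + 1)).add (hgi.const_mul C₁)) (hdb n)
    simp only [Pi.add_apply] at this
    rw [integral_add ((hi n).const_mul (1 + 1)) (hgi.const_mul C₁), integral_const_mul,
      integral_const_mul] at this
    linarith [hK n]
  have hK'0 : 0 ≤ K' := (integral_nonneg fun x => by positivity).trans (hdK 0)
  set D : ℕ → α → ℝ := fun n x => |f n x| ^ p - |f n x - g x| ^ p - |g x| ^ p with hD
  have hDi : ∀ n, Integrable (D n) μ := fun n => ((hi n).sub (hdi n)).sub hgi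
  have hDlim : ∀ᵐ x ∂μ, Tendsto (fun n => D n x) atTop (𝓝 0) := by
    filter_upwards [hlim] with x hx
    have h1 := hx.abs.rpow_const (p := p) (Or.inr hp0.le)
    have h2 := (hx.sub_const (g x)).abs.rpow_const (p := p) (Or.inr hp0.le)
    have h3 := (h1.sub h2).sub_const (|g x| ^ p)
    simpa [Real.zero_rpow hp0.ne'] using h3
  suffices h : Tendsto (fun n => ∫ x, D n x ∂μ) atTop (𝓝 0) by
    have h' := h.add_const (∫ x, |g x| ^ p ∂μ)
    rw [zero_add] at h'
    refine h'.congr fun n => ?_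
    simp only [hD]
    have e := integral_sub ((hi n).sub (hdi n)) hgi
    simp only [Pi.sub_apply] at e
    rw [e, integral_sub (hi n) (hdi n), sub_add_cancel]
  rw [Metric.tendsto_atTop]
  intro ε hε
  set η := ε / (2 * (K' + 1)) with hη
  have hηpos : 0 < η := by positivity
  obtain ⟨C, hC, hCb⟩ := abs_abs_add_rpow_sub_le hp hηpos
  set H : ℕ → α → ℝ := fun n x => max (|D n x| - η * |f n x - g x| ^ p) 0 with hH
  have hHi : ∀ n, Integrable (H n) μ := fun n => ((hDi n).abs.sub ((hdi n).const_mul η)).pos_part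
  have hHlim : Tendsto (fun n => ∫ x, H n x ∂μ) atTop (𝓝 (∫ _, (0 : ℝ) ∂μ)) := by
    refine tendsto_integral_of_dominated_convergence (fun x => (C + 1) * |g x| ^ p)
      (fun n => (hHi n).1) (hgi.const_mul _) (fun n => ae_of_all _ fun x => ?_) ?_
    · rw [Real.norm_of_nonneg (le_max_right _ _)]
      refine max_le ?_ (by positivity)
      have h1 := hCb (f n x - g x) (g x)
      rw [sub_add_cancel] at h1
      have h2 := abs_sub (|f n x| ^ p - |f n x - g x| ^ p) (|g x| ^ p)
      have h3 : |(|g x| ^ p)| = |g x| ^ p := abs_of_nonneg (by positivity)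
      simp only [hD]
      linarith
    · filter_upwards [hDlim, hlim] with x hx hx2
      have h2 := (hx2.sub_const (g x)).abs.rpow_const (p := p) (Or.inr hp0.le)
      have h3 := (hx.abs.sub (h2.const_mul η)).max (tendsto_const_nhds (x := (0 : ℝ)))
      simpa [Real.zero_rpow hp0.ne'] using h3
  rw [integral_zero] at hHlim
  obtain ⟨n₀, hn₀⟩ := Metric.tendsto_atTop.1 hHlim (ε / 2) (by positivity)
  refine ⟨n₀, fun n hn => ?_⟩
  have h1 := hn₀ n hn
  rw [Real.dist_eq, sub_zero] at h1 ⊢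
  have h2 : ∫ x, |D n x| ∂μ ≤ ∫ x, (H n x + η * |f n x - g x| ^ p) ∂μ := by
    refine integral_mono (hDi n).abs ((hHi n).add ((hdi n).const_mul η)) fun x => ?_
    have := le_max_left (|D n x| - η * |f n x - g x| ^ p) 0
    simp only [hH]; linarith
  rw [integral_add (hHi n) ((hdi n).const_mul η), integral_const_mul] at h2
  have h3 : η * ∫ x, |f n x - g x| ^ p ∂μ ≤ ε / 2 := by
    calc η * ∫ x, |f n x - g x| ^ p ∂μ ≤ η * (K' + 1) := by
          refine mul_le_mul_of_nonneg_left ?_ hηpos.le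
          linarith [hdK n]
      _ = ε / 2 := by rw [hη]; field_simp
  calc |∫ x, D n x ∂μ| ≤ ∫ x, |D n x| ∂μ := abs_integral_le_integral_abs
    _ ≤ _ := h2
    _ < ε := by linarith [le_abs_self (∫ x, H n x ∂μ)]

/-! ### Compactness of the embedding of `X₀` into `L²` -/

theorem integrableOn_ball_of_memLp_two (hw : MemLp w 2 volume) (x : EuclideanSpace ℝ (Fin N))
    (r : ℝ) : IntegrableOn w (Metric.ball x r) := by
  have : IsFiniteMeasure (volume.restrict (Metric.ball x r)) :=
    isFiniteMeasure_restrict.2 measure_ball_lt_top.ne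
  exact (hw.restrict (Metric.ball x r)).integrable one_le_two

/-- Integrate `w(x)² - 2 w(x) w(y) ≤ (w(x) - w(y))²` over the ball and absorb the cross term by
Young's inequality. The first term is small with `r` uniformly on bounded sets of `X₀`; the second
sees only ball averages, which behave well under weak convergence. -/
theorem sq_le_fiber_add_average (hs : 0 < s) (hw : MemLp w 2 volume)
    {x : EuclideanSpace ℝ (Fin N)} (hx : Integrable (fun y => kernel s w w (x, y)) volume)
    {r : ℝ} (hr : 0 < r) :
    w x ^ 2 ≤ 2 * r ^ (2 * s) / volume.real (Metric.ball (0 : EuclideanSpace ℝ (Fin N)) 1)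
        * (∫ y, kernel s w w (x, y))
      + 4 / volume.real (Metric.ball (0 : EuclideanSpace ℝ (Fin N)) r) ^ 2
        * (∫ y in Metric.ball x r, w y) ^ 2 := by
  have hω : 0 < volume.real (Metric.ball (0 : EuclideanSpace ℝ (Fin N)) 1) :=
    volume_real_ball_pos 0 one_pos
  have hV0 : volume.real (Metric.ball (0 : EuclideanSpace ℝ (Fin N)) r)
      = r ^ (N : ℝ) * volume.real (Metric.ball (0 : EuclideanSpace ℝ (Fin N)) 1) :=
    volume_real_ball 0 hr
  have hVx : volume.real (Metric.ball x r)
      = volume.real (Metric.ball (0 : EuclideanSpace ℝ (Fin N)) r) := by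
    rw [volume_real_ball x hr, hV0]
  have hVpos : 0 < volume.real (Metric.ball (0 : EuclideanSpace ℝ (Fin N)) r) :=
    volume_real_ball_pos 0 hr
  have hwi := integrableOn_ball_of_memLp_two hw x r
  have hi1 : IntegrableOn (fun y => r ^ ((N : ℝ) + 2 * s) * kernel s w w (x, y))
      (Metric.ball x r) := (hx.const_mul _).integrableOn
  have hic : IntegrableOn (fun _ : EuclideanSpace ℝ (Fin N) => w x ^ 2) (Metric.ball x r) :=
    integrableOn_const measure_ball_lt_top.ne
  have hil : IntegrableOn (fun y => 2 * w x * w y) (Metric.ball x r) := hwi.const_mul _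
  have hmain := setIntegral_mono_on (μ := volume) (s := Metric.ball x r) (hic.sub hil) hi1
    measurableSet_ball (fun y hy => by
      have h1 : (w x - w y) ^ 2 ≤ r ^ ((N : ℝ) + 2 * s) * kernel s w w (x, y) := by
        apply sq_sub_le_mul_kernel hs
        rw [← dist_eq_norm, dist_comm]; exact (Metric.mem_ball.1 hy).le
      simp only [Pi.sub_apply]
      nlinarith [sq_nonneg (w y)])
  simp only [Pi.sub_apply] at hmain
  rw [integral_sub hic hil, integral_const_mul, setIntegral_const, smul_eq_mul, hVx] at hmain
  have h2 := hmain.trans (setIntegral_sq_sub_le hx hr)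
  set V := volume.real (Metric.ball (0 : EuclideanSpace ℝ (Fin N)) r)
  set ω := volume.real (Metric.ball (0 : EuclideanSpace ℝ (Fin N)) 1)
  set I := ∫ y in Metric.ball x r, w y
  set G := ∫ y, kernel s w w (x, y)
  have h3 : 2 * w x * I ≤ V * w x ^ 2 / 2 + 2 * I ^ 2 / V := by
    have : 0 ≤ (V * w x - 2 * I) ^ 2 / (2 * V) := by positivity
    have e : (V * w x - 2 * I) ^ 2 / (2 * V) = V * w x ^ 2 / 2 + 2 * I ^ 2 / V - 2 * w x * I := by
      field_simp; ring
    linarith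
  have h4 : V * w x ^ 2 ≤ 2 * (r ^ ((N : ℝ) + 2 * s) * G) + 4 * I ^ 2 / V := by
    have : 4 * I ^ 2 / V = 2 * (2 * I ^ 2 / V) := by ring
    linarith
  have h5 : w x ^ 2 ≤ (2 * (r ^ ((N : ℝ) + 2 * s) * G) + 4 * I ^ 2 / V) / V := by
    rw [le_div_iff₀ hVpos]; linarith
  refine h5.trans_eq ?_
  have hrN : 0 < r ^ (N : ℝ) := by positivity
  rw [add_div, Real.rpow_add hr]
  congr 1
  · rw [hV0]; field_simp
  · field_simp

theorem abs_setIntegral_ball_le (hw : MemLp w 2 volume) (x : EuclideanSpace ℝ (Fin N)) {r : ℝ}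
    (hr : 0 < r) :
    |∫ y in Metric.ball x r, w y|
      ≤ volume.real (Metric.ball (0 : EuclideanSpace ℝ (Fin N)) r) + ∫ y, w y ^ 2 := by
  have hi := integrableOn_ball_of_memLp_two hw x r
  have h1 : IntegrableOn (fun _ => (1 : ℝ)) (Metric.ball x r) volume :=
    integrableOn_const measure_ball_lt_top.ne
  have h2 : IntegrableOn (fun y => w y ^ 2) (Metric.ball x r) volume := hw.integrable_sq.integrableOn
  have h3 : ∫ y in Metric.ball x r, |w y| ≤ ∫ y in Metric.ball x r, (1 + w y ^ 2) := by
    refine setIntegral_mono hi.abs (h1.add h2) fun y => ?_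
    simp only
    rw [← sq_abs]; nlinarith [sq_nonneg (|w y| - 1), abs_nonneg (w y)]
  rw [integral_add h1 h2, setIntegral_const, smul_eq_mul, mul_one, volume_real_ball x hr,
    ← volume_real_ball 0 hr] at h3
  have h4 : ∫ y in Metric.ball x r, w y ^ 2 ≤ ∫ y, w y ^ 2 :=
    setIntegral_le_integral hw.integrable_sq (ae_of_all _ fun y => sq_nonneg _)
  exact abs_integral_le_integral_abs.trans (h3.trans (by linarith))

theorem aestronglyMeasurable_setIntegral_ball (hw : MemLp w 2 volume) (r : ℝ) :
    AEStronglyMeasurable (fun x => ∫ y in Metric.ball x r, w y) volume := by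
  have hS : MeasurableSet
      {p : EuclideanSpace ℝ (Fin N) × EuclideanSpace ℝ (Fin N) | dist p.2 p.1 < r} :=
    (isOpen_lt (by fun_prop) continuous_const).measurableSet
  have h1 : AEStronglyMeasurable
      ({p : EuclideanSpace ℝ (Fin N) × EuclideanSpace ℝ (Fin N) | dist p.2 p.1 < r}.indicator
        (fun p => w p.2)) (volume.prod volume) := hw.1.comp_snd.indicator hS
  refine h1.integral_prod_right'.congr (ae_of_all _ fun x => ?_)
  simp only
  rw [← integral_indicator measurableSet_ball]
  rfl

theorem MemX0.integral_sq_eq (hw : MemX0 s Ω w) (hΩm : MeasurableSet Ω) :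
    ∫ x, w x ^ 2 = ∫ x in Ω, w x ^ 2 := by
  rw [← integral_add_compl hΩm hw.memHs.memLp.integrable_sq]
  have : ∫ x in Ωᶜ, w x ^ 2 = 0 := by
    refine integral_eq_zero_of_ae ?_
    filter_upwards [hw.zero_outside] with x hx
    simp [hx]
  rw [this, add_zero]

theorem integrableOn_sq_setIntegral_ball (hw : MemLp w 2 volume) (hΩf : volume Ω ≠ ⊤) {r : ℝ}
    (hr : 0 < r) : IntegrableOn (fun x => (∫ y in Metric.ball x r, w y) ^ 2) Ω := by
  refine (integrableOn_const (C := (volume.real (Metric.ball (0 : EuclideanSpace ℝ (Fin N)) r)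
    + ∫ y, w y ^ 2) ^ 2) hΩf).mono'
    ((aestronglyMeasurable_setIntegral_ball hw r).pow 2).restrict (ae_of_all _ fun x => ?_)
  rw [Real.norm_of_nonneg (sq_nonneg _), ← sq_abs]
  exact pow_le_pow_left₀ (abs_nonneg _) (abs_setIntegral_ball_le hw x hr) 2

theorem MemX0.integral_sq_le (hs : 0 < s) (hw : MemX0 s Ω w) (hΩm : MeasurableSet Ω)
    (hΩf : volume Ω ≠ ⊤) {r : ℝ} (hr : 0 < r) :
    ∫ x, w x ^ 2
      ≤ 2 * r ^ (2 * s) / volume.real (Metric.ball (0 : EuclideanSpace ℝ (Fin N)) 1) * form s w w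
      + 4 / volume.real (Metric.ball (0 : EuclideanSpace ℝ (Fin N)) r) ^ 2
        * ∫ x in Ω, (∫ y in Metric.ball x r, w y) ^ 2 := by
  have hω : 0 < volume.real (Metric.ball (0 : EuclideanSpace ℝ (Fin N)) 1) :=
    volume_real_ball_pos 0 one_pos
  have hi1 := (hw.memHs.integrable_integral_fiber).const_mul
    (2 * r ^ (2 * s) / volume.real (Metric.ball (0 : EuclideanSpace ℝ (Fin N)) 1))
  have hi2 := (integrableOn_sq_setIntegral_ball hw.memHs.memLp hΩf hr).const_mul
    (4 / volume.real (Metric.ball (0 : EuclideanSpace ℝ (Fin N)) r) ^ 2)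
  rw [hw.integral_sq_eq hΩm]
  have h := setIntegral_mono_ae (μ := volume) (s := Ω) hw.memHs.memLp.integrable_sq.integrableOn
    (hi1.integrableOn.add hi2) (by
      filter_upwards [hw.memHs.integrable_fiber] with x hx
      exact sq_le_fiber_add_average hs hw.memHs.memLp hx hr)
  simp only [Pi.add_apply] at h
  rw [integral_add hi1.integrableOn hi2, integral_const_mul, integral_const_mul] at h
  refine h.trans (add_le_add_left (mul_le_mul_of_nonneg_left ?_ (by positivity)) _)
  rw [← hw.memHs.integral_fiber]
  exact setIntegral_le_integral hw.memHs.integrable_integral_fiber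
    (ae_of_all _ fun x => integral_fiber_nonneg s w x)

theorem norm_toLp_sq {α : Type*} [MeasurableSpace α] {μ : Measure α} {f : α → ℝ}
    (hf : MemLp f 2 μ) : ‖hf.toLp f‖ ^ 2 = ∫ x, f x ^ 2 ∂μ := by
  rw [← real_inner_self_eq_norm_sq, L2.inner_def]
  refine integral_congr_ae ?_
  filter_upwards [hf.coeFn_toLp] with x hx
  simp [hx, sq]

/-- A bounded sequence in `L²` has a subsequence whose averages over balls converge. -/
theorem exists_subseq_tendsto_setIntegral_ball {f : ℕ → EuclideanSpace ℝ (Fin N) → ℝ} {K : ℝ}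
    (hf : ∀ n, MemLp (f n) 2 volume) (hK : ∀ n, ∫ x, f n x ^ 2 ≤ K) :
    ∃ ns : ℕ → ℕ, StrictMono ns ∧ ∀ x r, ∃ l,
      Tendsto (fun n => ∫ y in Metric.ball x r, f (ns n) y) atTop (𝓝 l) := by
  have : Fact ((2 : ENNReal) ≠ ⊤) := ⟨ENNReal.ofNat_ne_top⟩
  -- Sequential Banach-Alaoglu in the dual of `L²`. Every ball average is a pairing with an
  -- indicator, so one subsequence serves all balls at once.
  let T : ℕ → WeakDual ℝ (Lp ℝ 2 (volume : Measure (EuclideanSpace ℝ (Fin N)))) := fun n =>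
    StrongDual.toWeakDual (innerSL ℝ ((hf n).toLp (f n)))
  have hT : ∀ n, T n ∈ WeakDual.toStrongDual ⁻¹' Metric.closedBall
      (0 : StrongDual ℝ (Lp ℝ 2 (volume : Measure (EuclideanSpace ℝ (Fin N))))) (√K) := by
    intro n
    simp only [T, Set.mem_preimage, mem_closedBall_zero_iff]
    have : ‖innerSL ℝ ((hf n).toLp (f n))‖ ≤ √K := by
      rw [innerSL_apply_norm]
      refine Real.le_sqrt_of_sq_le ?_
      rw [norm_toLp_sq]; exact hK n
    exact this
  obtain ⟨a, -, ns, hns, hlim⟩ := WeakDual.isSeqCompact_closedBall ℝ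
    (Lp ℝ 2 (volume : Measure (EuclideanSpace ℝ (Fin N)))) 0 (√K) hT
  refine ⟨ns, hns, fun x r => ⟨a (indicatorConstLp 2 (measurableSet_ball (x := x) (ε := r))
    measure_ball_lt_top.ne (1 : ℝ)), ?_⟩⟩
  have h := ((WeakDual.eval_continuous (indicatorConstLp 2 (measurableSet_ball (x := x) (ε := r))
    measure_ball_lt_top.ne (1 : ℝ))).tendsto a).comp hlim
  refine h.congr fun n => ?_
  have h2 : T (ns n) (indicatorConstLp 2 (measurableSet_ball (x := x) (ε := r))
      measure_ball_lt_top.ne (1 : ℝ)) = inner ℝ ((hf (ns n)).toLp (f (ns n)))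
      (indicatorConstLp 2 (measurableSet_ball (x := x) (ε := r))
        measure_ball_lt_top.ne (1 : ℝ)) := rfl
  simp only [Function.comp_apply]
  rw [h2, real_inner_comm, L2.inner_indicatorConstLp_one]
  exact setIntegral_congr_ae measurableSet_ball
    ((hf (ns n)).coeFn_toLp.mono fun y hy _ => hy)

/-- Rellich's theorem for `X₀`. -/
theorem exists_subseq_tendsto_L2 (hs : 0 < s) (hΩm : MeasurableSet Ω) (hΩf : volume Ω ≠ ⊤)
    {f : ℕ → EuclideanSpace ℝ (Fin N) → ℝ} {K R : ℝ} (hf : ∀ n, MemX0 s Ω (f n))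
    (hK : ∀ n, ∫ x, f n x ^ 2 ≤ K) (hR : ∀ n, form s (f n) (f n) ≤ R) :
    ∃ (ns : ℕ → ℕ) (g : EuclideanSpace ℝ (Fin N) → ℝ), StrictMono ns ∧ MemLp g 2 volume ∧
      (∀ᵐ x, Tendsto (fun n => f (ns n) x) atTop (𝓝 (g x))) ∧
      Tendsto (fun n => ∫ x, (f (ns n) x - g x) ^ 2) atTop (𝓝 0) := by
  have hL : ∀ n, MemLp (f n) 2 volume := fun n => (hf n).memHs.memLp
  obtain ⟨ns, hns, hav⟩ := exists_subseq_tendsto_setIntegral_ball hL hK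
  set ω := volume.real (Metric.ball (0 : EuclideanSpace ℝ (Fin N)) 1) with hω
  have hω0 : 0 < ω := volume_real_ball_pos 0 one_pos
  -- For fixed `r` the averages of differences tend to 0 pointwise and are bounded by a constant on
  -- the finite-measure set `Ω`.
  have hI : ∀ r, 0 < r → Tendsto (fun q : ℕ × ℕ => ∫ x in Ω,
      (∫ y in Metric.ball x r, (f (ns q.1) y - f (ns q.2) y)) ^ 2) atTop (𝓝 0) := by
    intro r hr
    have hsplit : ∀ (q : ℕ × ℕ) x, ∫ y in Metric.ball x r, (f (ns q.1) y - f (ns q.2) y)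
        = (∫ y in Metric.ball x r, f (ns q.1) y) - ∫ y in Metric.ball x r, f (ns q.2) y :=
      fun q x => integral_sub (integrableOn_ball_of_memLp_two (hL _) x r)
        (integrableOn_ball_of_memLp_two (hL _) x r)
    set V := volume.real (Metric.ball (0 : EuclideanSpace ℝ (Fin N)) r)
    have h := tendsto_integral_filter_of_dominated_convergence (μ := volume.restrict Ω)
      (l := (atTop : Filter (ℕ × ℕ)))
      (F := fun q x => (∫ y in Metric.ball x r, (f (ns q.1) y - f (ns q.2) y)) ^ 2)
      (f := fun _ => 0) (fun _ => (2 * (V + K)) ^ 2)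
      (Eventually.of_forall fun q =>
        ((aestronglyMeasurable_setIntegral_ball ((hL _).sub (hL _)) r).pow 2).restrict)
      (Eventually.of_forall fun q => ae_of_all _ fun x => by
        rw [Real.norm_of_nonneg (sq_nonneg _), ← sq_abs, hsplit]
        refine pow_le_pow_left₀ (abs_nonneg _) ?_ 2
        have h1 := abs_setIntegral_ball_le (hL (ns q.1)) x hr
        have h2 := abs_setIntegral_ball_le (hL (ns q.2)) x hr
        refine (abs_sub _ _).trans ?_
        linarith [hK (ns q.1), hK (ns q.2)])
      (integrableOn_const hΩf)
      (ae_of_all _ fun x => by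
        obtain ⟨l, hl⟩ := hav x r
        have h1 : Tendsto (fun q : ℕ × ℕ => ∫ y in Metric.ball x r, f (ns q.1) y) atTop (𝓝 l) := by
          rw [← prod_atTop_atTop_eq]; exact hl.comp tendsto_fst
        have h2 : Tendsto (fun q : ℕ × ℕ => ∫ y in Metric.ball x r, f (ns q.2) y) atTop (𝓝 l) := by
          rw [← prod_atTop_atTop_eq]; exact hl.comp tendsto_snd
        simp only [hsplit]
        simpa using (h1.sub h2).pow 2)
    simpa using h
  have hcau : ∀ ε > 0, ∃ n₀, ∀ m ≥ n₀, ∀ n ≥ n₀, ∫ x, (f (ns m) x - f (ns n) x) ^ 2 < ε := by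
    intro ε hε
    -- The radius is fixed first, making the fiber term small for all pairs, since a difference has
    -- form at most `4R`; only then are the indices taken large.
    have hlim : Tendsto (fun r : ℝ => 2 * r ^ (2 * s) / ω * (4 * R)) (𝓝[>] 0) (𝓝 0) := by
      have h1 : ContinuousAt (fun r : ℝ => 2 * r ^ (2 * s) / ω * (4 * R)) 0 :=
        (((Real.continuousAt_rpow_const 0 _ (Or.inr (by linarith))).const_mul 2).div_const
          ω).mul_const (4 * R)
      have h2 := h1.tendsto
      rw [Real.zero_rpow (by linarith), mul_zero, zero_div, zero_mul] at h2
      exact h2.mono_left nhdsWithin_le_nhds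
    obtain ⟨r, hr, hr0⟩ := ((hlim.eventually (gt_mem_nhds (half_pos hε))).and
      self_mem_nhdsWithin).exists
    have hr0 : 0 < r := hr0
    have hl2 := (hI r hr0).const_mul
      (4 / volume.real (Metric.ball (0 : EuclideanSpace ℝ (Fin N)) r) ^ 2)
    rw [mul_zero] at hl2
    obtain ⟨⟨a, b⟩, hab⟩ := eventually_atTop.1 (hl2.eventually (gt_mem_nhds (half_pos hε)))
    refine ⟨max a b, fun m hm n hn => ?_⟩
    have h1 := hab (m, n) ⟨(le_max_left a b).trans hm, (le_max_right a b).trans hn⟩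
    have h2 := ((hf (ns m)).sub (hf (ns n))).integral_sq_le hs hΩm hΩf hr0
    have h3 : form s (fun x => f (ns m) x - f (ns n) x) (fun x => f (ns m) x - f (ns n) x)
        ≤ 4 * R := by
      have := (hf (ns m)).memHs.form_sub_self_le (hf (ns n)).memHs
      linarith [hR (ns m), hR (ns n)]
    have h4 := mul_le_mul_of_nonneg_left h3 (by positivity : 0 ≤ 2 * r ^ (2 * s) / ω)
    simp only at h1
    linarith
  let U : ℕ → Lp ℝ 2 (volume : Measure (EuclideanSpace ℝ (Fin N))) := fun n =>
    (hL (ns n)).toLp (f (ns n))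
  have hU : CauchySeq U := by
    rw [Metric.cauchySeq_iff]
    intro ε hε
    obtain ⟨n₀, h⟩ := hcau (ε ^ 2) (by positivity)
    refine ⟨n₀, fun m hm n hn => ?_⟩
    have h1 := h m hm n hn
    rw [dist_eq_norm, ← MemLp.toLp_sub]
    refine lt_of_pow_lt_pow_left₀ 2 hε.le ?_
    rw [norm_toLp_sq]
    exact h1
  obtain ⟨G, hG⟩ := cauchySeq_tendsto_of_complete hU
  obtain ⟨ms, hms, hae⟩ := (tendstoInMeasure_of_tendsto_Lp hG).exists_seq_tendsto_ae
  refine ⟨ns ∘ ms, G, hns.comp hms, Lp.memLp G, ?_, ?_⟩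
  · have hall : ∀ᵐ x, ∀ n, U n x = f (ns n) x := ae_all_iff.2 fun n => (hL (ns n)).coeFn_toLp
    filter_upwards [hae, hall] with x hx hx2
    simpa only [hx2, Function.comp_apply] using hx
  · have h1 : Tendsto (fun n => ‖U (ms n) - G‖ ^ 2) atTop (𝓝 0) := by
      have := ((hG.comp hms.tendsto_atTop).sub_const G).norm.pow 2
      simpa using this
    refine h1.congr fun n => ?_
    have h2 : U (ms n) - G = ((hL (ns (ms n))).sub (Lp.memLp G)).toLp _ := by
      rw [MemLp.toLp_sub (hL _) (Lp.memLp G), Lp.toLp_coeFn]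
    rw [h2, norm_toLp_sq]
    rfl

/-! ### Minimization of the energy over a ball -/

theorem gnorm_const_mul (s : ℝ) {t : ℝ} (ht : 0 ≤ t) (u : EuclideanSpace ℝ (Fin N) → ℝ) :
    gnorm s (fun x => t * u x) = t * gnorm s u := by
  rw [gnorm, form_const_mul_self, Real.sqrt_mul (sq_nonneg t), Real.sqrt_sq ht, gnorm]

theorem energy_eq_of_nonneg (s θ γ : ℝ) (Ω : Set (EuclideanSpace ℝ (Fin N))) (lam : ℝ)
    (h0 : ∀ x, 0 ≤ u x) :
    energy s θ γ Ω lam u = 1 / (2 * θ) * form s u u ^ θ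
      - lam / (1 - γ) * (∫ x in Ω, u x ^ (1 - γ))
      - 1 / critExp N s * (∫ x in Ω, u x ^ critExp N s) := by
  simp only [energy, gnorm_rpow, max_eq_left (h0 _)]

theorem energy_const_mul (s θ γ : ℝ) (Ω : Set (EuclideanSpace ℝ (Fin N))) (lam : ℝ)
    {t : ℝ} (ht : 0 < t) (h0 : ∀ x, 0 ≤ u x) :
    energy s θ γ Ω lam (fun x => t * u x) = 1 / (2 * θ) * (t ^ (2 * θ) * form s u u ^ θ)
      - lam / (1 - γ) * (t ^ (1 - γ) * ∫ x in Ω, u x ^ (1 - γ))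
      - 1 / critExp N s * (t ^ critExp N s * ∫ x in Ω, u x ^ critExp N s) := by
  rw [energy_eq_of_nonneg s θ γ Ω lam (fun x => mul_nonneg ht.le (h0 x)), form_const_mul_self,
    Real.mul_rpow (sq_nonneg t) (form_self_nonneg s u), ← Real.rpow_two, ← Real.rpow_mul ht.le]
  simp only [Real.mul_rpow ht.le (h0 _), integral_const_mul]

theorem energy_posPart_le {θ γ lam : ℝ} (hθ : 0 < θ) (hu : MemHs s u) :
    energy s θ γ Ω lam (fun x => max (u x) 0) ≤ energy s θ γ Ω lam u := by
  simp only [energy, max_eq_left (le_max_right (u _) (0 : ℝ)), gnorm_rpow]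
  have := Real.rpow_le_rpow (form_self_nonneg s _)
    (hu.form_comp_le lipschitzWith_max_zero (max_self 0)) hθ.le
  have := mul_le_mul_of_nonneg_left this (by positivity : 0 ≤ 1 / (2 * θ))
  linarith

/-- On the small ball the critical term is controlled by the Kirchhoff term. -/
theorem Geometry.critical_le {θ γ ρ lam₀ α : ℝ} (hs : 0 < s) (hN : 2 * s < N)
    (hθ : 0 < θ) (hγ₁ : γ < 1) (hgeo : Geometry s θ γ Ω ρ lam₀ α)
    (hw : MemX0 s Ω w) :
    1 / critExp N s * (∫ x in Ω, |w x| ^ critExp N s)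
      ≤ 1 / (2 * θ) * (ρ ^ (2 * θ - critExp N s) * form s w w ^ (critExp N s / 2)) := by
  have hp := critExp_pos hs hN
  set p := critExp N s with hpdef
  have hρ := hgeo.rho_pos
  -- The energy sees only positive parts, so the argument runs for `|w|`, whose form is no larger.
  have hu := hw.comp lipschitzWith_abs abs_zero
  have hle := hw.memHs.form_comp_le lipschitzWith_abs abs_zero
  have hle2 := Real.rpow_le_rpow (form_self_nonneg s _) hle (by positivity : 0 ≤ p / 2)
  have hC : 0 ≤ 1 / (2 * θ) * ρ ^ (2 * θ - p) := by positivity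
  suffices h : 1 / p * (∫ x in Ω, |w x| ^ p) ≤ 1 / (2 * θ) * (ρ ^ (2 * θ - p)
      * form s (fun x => |w x|) (fun x => |w x|) ^ (p / 2)) by
    refine h.trans ?_
    rw [← mul_assoc, ← mul_assoc]
    exact mul_le_mul_of_nonneg_left hle2 hC
  set F := form s (fun x => |w x|) (fun x => |w x|) with hF
  rcases (form_self_nonneg s (fun x => |w x|)).eq_or_lt with h0 | h0
  · obtain ⟨S, hS, h⟩ := sobolev (N := N) hs hN
    have h1 := (h _ hu.memHs)
    rw [← h0, Real.zero_rpow (by positivity), mul_zero] at h1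
    simp only [abs_abs] at h1
    have h2 : ∫ x in Ω, |w x| ^ p ≤ 0 :=
      (setIntegral_le_integral h1.1 (ae_of_all _ fun x => by positivity)).trans h1.2
    have h3 : 1 / p * (∫ x in Ω, |w x| ^ p) ≤ 0 :=
      mul_nonpos_of_nonneg_of_nonpos (by positivity) h2
    refine h3.trans ?_
    rw [← mul_assoc]
    exact mul_nonneg hC (Real.rpow_nonneg (form_self_nonneg _ _) _)
  · rw [← hF] at h0
    have hg : 0 < gnorm s (fun x => |w x|) := Real.sqrt_pos.2 h0
    set G := gnorm s (fun x => |w x|) with hG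
    have ht : 0 < ρ / G := by positivity
    -- The multiple of `|w|` on the sphere has positive energy. Dropping the singular term, which
    -- enters with a minus sign, leaves critical ≤ Kirchhoff there; homogeneity carries this back to
    -- `|w|`.
    have hb := hgeo.bound lam₀ hgeo.lam₀_pos le_rfl _ (hu.const_mul (ρ / G))
      (by rw [gnorm_const_mul s ht.le, ← hG, div_mul_cancel₀ _ hg.ne'])
    rw [energy_const_mul s θ γ Ω lam₀ ht (fun x => abs_nonneg _), ← hpdef, ← hF] at hb
    have h1 : 0 ≤ lam₀ / (1 - γ) * ((ρ / G) ^ (1 - γ) * ∫ x in Ω, |w x| ^ (1 - γ)) :=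
      mul_nonneg (div_nonneg hgeo.lam₀_pos.le (by linarith))
        (mul_nonneg (by positivity) (integral_nonneg fun x => by positivity))
    have hα := hgeo.alpha_pos
    have h2 : (ρ / G) ^ p * (1 / p * ∫ x in Ω, |w x| ^ p)
        ≤ 1 / (2 * θ) * ((ρ / G) ^ (2 * θ) * F ^ θ) := by
      have : (ρ / G) ^ p * (1 / p * ∫ x in Ω, |w x| ^ p)
        = 1 / p * ((ρ / G) ^ p * ∫ x in Ω, |w x| ^ p) := by ring
      linarith
    have hFG : F = G ^ (2 : ℝ) := by rw [Real.rpow_two, hG, gnorm_sq]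
    have h3 : (ρ / G) ^ (2 * θ) * F ^ θ = (ρ / G) ^ p * (ρ ^ (2 * θ - p) * F ^ (p / 2)) := by
      rw [hFG, ← Real.rpow_mul hg.le, ← Real.rpow_mul hg.le, Real.div_rpow hρ.le hg.le,
        Real.div_rpow hρ.le hg.le, mul_div_cancel₀ p (two_ne_zero' ℝ), Real.rpow_sub hρ]
      field_simp
    rw [h3] at h2
    refine le_of_mul_le_mul_left (h2.trans_eq ?_) (by positivity : 0 < (ρ / G) ^ p)
    ring

/-- Along `tφ` with `φ` positive in `Ω`, the singular term is of order `t^(1-γ)` and the Kirchhoff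
term of order `t^(2θ)`, with `1 - γ < 2θ`; the critical term only lowers the energy. -/
theorem exists_energy_neg {θ γ lam ρ : ℝ} (hs : 0 < s) (hs₁ : s < 1) (hN : 2 * s < N)
    (hθ : 1 < θ) (hγ₀ : 0 < γ) (hγ₁ : γ < 1) (hΩo : IsOpen Ω) (hΩb : Bornology.IsBounded Ω)
    (hΩn : Ω.Nonempty) (hlam : 0 < lam) (hρ : 0 < ρ) :
    ∃ v, MemX0 s Ω v ∧ gnorm s v ≤ ρ ∧ energy s θ γ Ω lam v < 0 := by
  have hN0 : 0 < N := by
    have : (0 : ℝ) < N := by linarith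
    exact_mod_cast this
  have hΩf := hΩb.measure_lt_top (μ := volume).ne
  have hp := critExp_pos hs hN
  have hp2 := two_lt_critExp hs hN
  obtain ⟨φ, hφ, hφ0, hφpos⟩ := exists_memX0_pos hs hs₁ hN0 hΩo hΩb
  have h1γ : 0 < 1 - γ := by linarith
  have hB : 0 < ∫ x in Ω, φ x ^ (1 - γ) := by
    have hi : IntegrableOn (fun x => φ x ^ (1 - γ)) Ω := by
      have := hφ.memHs.integrableOn_posPart_rpow hs hN hΩf (q := 1 - γ) h1γ (by linarith)
      simpa only [max_eq_left (hφ0 _)] using this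
    rw [setIntegral_pos_iff_support_of_nonneg_ae
      (ae_of_all _ fun x => Real.rpow_nonneg (hφ0 x) _) hi]
    refine (hΩo.measure_pos volume hΩn).trans_le (measure_mono fun x hx => ⟨?_, hx⟩)
    exact (Real.rpow_pos_of_pos (hφpos x hx) _).ne'
  set A := 1 / (2 * θ) * form s φ φ ^ θ with hA
  set B := lam / (1 - γ) * ∫ x in Ω, φ x ^ (1 - γ) with hBdef
  have hBpos : 0 < B := by positivity
  have hl1 : Tendsto (fun t : ℝ => t ^ (2 * θ - (1 - γ)) * A) (𝓝[>] 0) (𝓝 0) := by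
    have h1 : ContinuousAt (fun t : ℝ => t ^ (2 * θ - (1 - γ)) * A) 0 :=
      (Real.continuousAt_rpow_const 0 _ (Or.inr (by linarith))).mul_const _
    have h2 := h1.tendsto
    rw [Real.zero_rpow (by linarith), zero_mul] at h2
    exact h2.mono_left nhdsWithin_le_nhds
  have hl2 : Tendsto (fun t : ℝ => t * gnorm s φ) (𝓝[>] 0) (𝓝 0) := by
    have h1 : Continuous (fun t : ℝ => t * gnorm s φ) := by fun_prop
    have h2 := h1.tendsto 0
    rw [zero_mul] at h2
    exact h2.mono_left nhdsWithin_le_nhds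
  obtain ⟨t, ⟨h1, h2⟩, ht⟩ := (((hl1.eventually (gt_mem_nhds hBpos)).and
    (hl2.eventually (gt_mem_nhds hρ))).and self_mem_nhdsWithin).exists
  have ht : 0 < t := ht
  refine ⟨fun x => t * φ x, hφ.const_mul t, ?_, ?_⟩
  · rw [gnorm_const_mul s ht.le]; exact h2.le
  · rw [energy_const_mul s θ γ Ω lam ht hφ0]
    have h3 : 0 ≤ 1 / critExp N s * (t ^ critExp N s * ∫ x in Ω, φ x ^ critExp N s) :=
      mul_nonneg (by positivity) (mul_nonneg (by positivity)
        (integral_nonneg fun x => Real.rpow_nonneg (hφ0 x) _))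
    have h4 : t ^ (2 * θ) = t ^ (1 - γ) * t ^ (2 * θ - (1 - γ)) := by
      rw [← Real.rpow_add ht]; congr 1; ring
    have h5 := mul_lt_mul_of_pos_left h1 (by positivity : 0 < t ^ (1 - γ))
    have h6 : 1 / (2 * θ) * (t ^ (2 * θ) * form s φ φ ^ θ)
        = t ^ (1 - γ) * (t ^ (2 * θ - (1 - γ)) * A) := by rw [h4, hA]; ring
    have h7 : lam / (1 - γ) * (t ^ (1 - γ) * ∫ x in Ω, φ x ^ (1 - γ)) = t ^ (1 - γ) * B := by
      rw [hBdef]; ring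
    linarith

/-! ### Passage to the limit along bounded sequences -/

theorem rpow_sub_rpow_abs_le {a b q : ℝ} (ha : 0 ≤ a) (hb : 0 ≤ b) (hq0 : 0 < q) (hq1 : q ≤ 1) :
    |a ^ q - b ^ q| ≤ |a - b| ^ q := by
  have key : ∀ a b : ℝ, 0 ≤ a → 0 ≤ b → b ≤ a → |a ^ q - b ^ q| ≤ |a - b| ^ q := by
    intro a b ha hb hab
    rw [abs_of_nonneg (sub_nonneg.2 (Real.rpow_le_rpow hb hab hq0.le)),
      abs_of_nonneg (sub_nonneg.2 hab)]
    have := Real.rpow_add_le_add_rpow (sub_nonneg.2 hab) hb hq0.le hq1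
    rw [sub_add_cancel] at this
    linarith
  rcases le_total b a with h | h
  · exact key a b ha hb h
  · rw [abs_sub_comm, abs_sub_comm a b]; exact key b a hb ha h

theorem rpow_le_add_sq {a q δ : ℝ} (ha : 0 ≤ a) (hδ : 0 < δ) (hq0 : 0 < q) (hq1 : q ≤ 1) :
    a ^ q ≤ δ ^ q + δ ^ (q - 2) * a ^ 2 := by
  rcases le_total a δ with h | h
  · have := Real.rpow_le_rpow ha h hq0.le
    have : 0 ≤ δ ^ (q - 2) * a ^ 2 := by positivity
    linarith
  · have ha' : 0 < a := hδ.trans_le h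
    have h1 : a ^ (q - 2) ≤ δ ^ (q - 2) := Real.rpow_le_rpow_of_nonpos hδ h (by linarith)
    have h2 : a ^ q = a ^ (q - 2) * a ^ 2 := by
      rw [← Real.rpow_two, ← Real.rpow_add ha']; congr 1; ring
    rw [h2]
    have := mul_le_mul_of_nonneg_right h1 (sq_nonneg a)
    have : 0 < δ ^ q := by positivity
    linarith

/-- Here `|f^q - u^q| ≤ |f - u|^q ≤ δ^q + δ^(q-2) |f - u|²`: on the finite-measure set `Ω` the first
term is small with `δ`, and the second then tends to 0 by `L²` convergence. -/
theorem tendsto_setIntegral_rpow {f : ℕ → EuclideanSpace ℝ (Fin N) → ℝ} {q : ℝ}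
    (hq0 : 0 < q) (hq1 : q ≤ 1) (hΩf : volume Ω ≠ ⊤)
    (hf0 : ∀ n x, 0 ≤ f n x) (hu0 : ∀ x, 0 ≤ u x)
    (hfi : ∀ n, IntegrableOn (fun x => f n x ^ q) Ω) (hui : IntegrableOn (fun x => u x ^ q) Ω)
    (hL : ∀ n, MemLp (fun x => f n x - u x) 2 volume)
    (hlim : Tendsto (fun n => ∫ x, (f n x - u x) ^ 2) atTop (𝓝 0)) :
    Tendsto (fun n => ∫ x in Ω, f n x ^ q) atTop (𝓝 (∫ x in Ω, u x ^ q)) := by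
  rw [Metric.tendsto_atTop]
  intro ε hε
  have hl1 : Tendsto (fun t : ℝ => t ^ q * volume.real Ω) (𝓝[>] 0) (𝓝 0) := by
    have h1 : ContinuousAt (fun t : ℝ => t ^ q * volume.real Ω) 0 :=
      (Real.continuousAt_rpow_const 0 _ (Or.inr hq0.le)).mul_const _
    have h2 := h1.tendsto
    rw [Real.zero_rpow hq0.ne', zero_mul] at h2
    exact h2.mono_left nhdsWithin_le_nhds
  obtain ⟨δ, h1, hδ⟩ := ((hl1.eventually (gt_mem_nhds (half_pos hε))).and
    self_mem_nhdsWithin).exists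
  have hδ : 0 < δ := hδ
  have hl2 := hlim.const_mul (δ ^ (q - 2))
  rw [mul_zero] at hl2
  obtain ⟨n₀, hn₀⟩ := eventually_atTop.1 (hl2.eventually (gt_mem_nhds (half_pos hε)))
  refine ⟨n₀, fun n hn => ?_⟩
  have h2 := hn₀ n hn
  have hc : IntegrableOn (fun _ : EuclideanSpace ℝ (Fin N) => δ ^ q) Ω := integrableOn_const hΩf
  have hd := ((hL n).integrable_sq).const_mul (δ ^ (q - 2))
  have h3 : ∫ x in Ω, |f n x ^ q - u x ^ q|
      ≤ ∫ x in Ω, (δ ^ q + δ ^ (q - 2) * (f n x - u x) ^ 2) := by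
    refine setIntegral_mono ((hfi n).sub hui).abs (hc.add hd.integrableOn) fun x => ?_
    refine (rpow_sub_rpow_abs_le (hf0 n x) (hu0 x) hq0 hq1).trans ?_
    rw [← sq_abs (f n x - u x)]
    exact rpow_le_add_sq (abs_nonneg _) hδ hq0 hq1
  rw [integral_add hc hd.integrableOn, setIntegral_const, smul_eq_mul] at h3
  have h4 := setIntegral_le_integral (s := Ω) hd
    (ae_of_all _ fun x => mul_nonneg (by positivity) (sq_nonneg _))
  rw [integral_const_mul _ (fun x => (f n x - u x) ^ 2),
    integral_const_mul _ (fun x => (f n x - u x) ^ 2)] at h4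
  rw [integral_const_mul] at h3
  rw [Real.dist_eq, ← integral_sub (hfi n) hui]
  refine abs_integral_le_integral_abs.trans_lt ?_
  linarith

/-- The Gagliardo difference quotient, whose square is `kernel s u u`. -/
def quotient (s : ℝ) (u : EuclideanSpace ℝ (Fin N) → ℝ)
    (p : EuclideanSpace ℝ (Fin N) × EuclideanSpace ℝ (Fin N)) : ℝ :=
  (u p.1 - u p.2) / ‖p.1 - p.2‖ ^ (((N : ℝ) + 2 * s) / 2)

theorem abs_quotient_rpow_two (s : ℝ) (u : EuclideanSpace ℝ (Fin N) → ℝ)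
    (p : EuclideanSpace ℝ (Fin N) × EuclideanSpace ℝ (Fin N)) :
    |quotient s u p| ^ (2 : ℝ) = kernel s u u p := by
  rw [Real.rpow_two, sq_abs, quotient, div_pow, ← Real.rpow_two (‖p.1 - p.2‖ ^ _),
    ← Real.rpow_mul (norm_nonneg _), div_mul_cancel₀ _ (two_ne_zero' ℝ), kernel, sq]

theorem quotient_sub (s : ℝ) (u v : EuclideanSpace ℝ (Fin N) → ℝ)
    (p : EuclideanSpace ℝ (Fin N) × EuclideanSpace ℝ (Fin N)) :
    quotient s u p - quotient s v p = quotient s (fun x => u x - v x) p := by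
  simp only [quotient]; ring

theorem aestronglyMeasurable_quotient (hu : AEStronglyMeasurable u volume) :
    AEStronglyMeasurable (quotient s u) volume := by
  unfold quotient
  rw [Measure.volume_eq_prod]
  have hd : AEStronglyMeasurable
      (fun p : EuclideanSpace ℝ (Fin N) × EuclideanSpace ℝ (Fin N) =>
        ‖p.1 - p.2‖ ^ (((N : ℝ) + 2 * s) / 2)) (volume.prod volume) := by
    apply Measurable.aestronglyMeasurable
    fun_prop
  exact (hu.comp_fst.sub hu.comp_snd).div₀ hd

theorem ae_tendsto_quotient {f : ℕ → EuclideanSpace ℝ (Fin N) → ℝ}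
    (hlim : ∀ᵐ x, Tendsto (fun n => f n x) atTop (𝓝 (u x))) :
    ∀ᵐ p, Tendsto (fun n => quotient s (f n) p) atTop (𝓝 (quotient s u p)) := by
  rw [Measure.volume_eq_prod]
  filter_upwards [Measure.quasiMeasurePreserving_fst.ae hlim,
    Measure.quasiMeasurePreserving_snd.ae hlim] with p h1 h2
  exact (h1.sub h2).div_const _

/-- Fatou's lemma for the Gagliardo form. -/
theorem memX0_of_tendsto {f : ℕ → EuclideanSpace ℝ (Fin N) → ℝ} {R : ℝ}
    (hf : ∀ n, MemX0 s Ω (f n)) (hR : ∀ n, form s (f n) (f n) ≤ R) (hu : MemLp u 2 volume)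
    (hlim : ∀ᵐ x, Tendsto (fun n => f n x) atTop (𝓝 (u x))) : MemX0 s Ω u where
  memHs := by
    refine ⟨hu, ?_⟩
    refine (integrable_and_integral_le_of_tendsto (fun n => (hf n).memHs.integrable)
      (fun n => ae_of_all _ (kernel_self_nonneg s (f n))) hR ?_).1
    filter_upwards [ae_tendsto_quotient (s := s) hlim] with p hp
    have := hp.abs.rpow_const (p := 2) (Or.inr zero_le_two)
    simpa only [abs_quotient_rpow_two] using this
  zero_outside := by
    filter_upwards [ae_restrict_of_ae hlim, ae_all_iff.2 fun n => (hf n).zero_outside] with x h1 h2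
    simp only [h2] at h1
    exact tendsto_nhds_unique h1 tendsto_const_nhds

/-- The form is the squared `L²` norm of `quotient` on the product space, so the case `p = 2` of
`brezis_lieb` replaces weak convergence in `X₀`. -/
theorem tendsto_form_sub {f : ℕ → EuclideanSpace ℝ (Fin N) → ℝ} {R : ℝ}
    (hf : ∀ n, MemX0 s Ω (f n)) (hR : ∀ n, form s (f n) (f n) ≤ R)
    (hlim : ∀ᵐ x, Tendsto (fun n => f n x) atTop (𝓝 (u x))) :
    Tendsto (fun n => form s (f n) (f n)
      - form s (fun x => f n x - u x) (fun x => f n x - u x)) atTop (𝓝 (form s u u)) := by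
  have := brezis_lieb (p := 2) one_lt_two (f := fun n => quotient s (f n)) (K := R)
    (fun n => aestronglyMeasurable_quotient (hf n).memHs.memLp.1)
    (fun n => by simpa only [abs_quotient_rpow_two] using (hf n).memHs.integrable)
    (fun n => by simpa only [abs_quotient_rpow_two, form] using hR n) (ae_tendsto_quotient hlim)
  simpa only [quotient_sub, abs_quotient_rpow_two, form] using this

/-- Along a bounded sequence of nonnegative functions in the ball of radius `ρ` the energy is
weakly lower semicontinuous. -/
theorem Geometry.exists_energy_le_of_tendsto {θ γ ρ lam₀ α lam m : ℝ} (hs : 0 < s)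
    (hN : 2 * s < N) (hθ₁ : 1 < θ) (hθ₂ : θ < critExp N s / 2) (hγ₀ : 0 < γ) (hγ₁ : γ < 1)
    (hΩm : MeasurableSet Ω) (hΩf : volume Ω ≠ ⊤) (hgeo : Geometry s θ γ Ω ρ lam₀ α)
    {f : ℕ → EuclideanSpace ℝ (Fin N) → ℝ} (hf : ∀ n, MemX0 s Ω (f n)) (hf0 : ∀ n x, 0 ≤ f n x)
    (hfρ : ∀ n, form s (f n) (f n) ≤ ρ ^ 2)
    (hm : Tendsto (fun n => energy s θ γ Ω lam (f n)) atTop (𝓝 m)) :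
    ∃ u, MemX0 s Ω u ∧ (∀ x, 0 ≤ u x) ∧ form s u u ≤ ρ ^ 2 ∧ energy s θ γ Ω lam u ≤ m := by
  have hp := critExp_pos hs hN
  have hp2 := two_lt_critExp hs hN
  have hρ := hgeo.rho_pos
  have h1γ : 0 < 1 - γ := by linarith
  have hpos : ∀ {v : EuclideanSpace ℝ (Fin N) → ℝ}, (∀ x, 0 ≤ v x) → MemX0 s Ω v →
      ∀ {q : ℝ}, 0 < q → q ≤ critExp N s → IntegrableOn (fun x => v x ^ q) Ω := by
    intro v hv0 hv q hq hqp
    simpa only [max_eq_left (hv0 _)] using hv.memHs.integrableOn_posPart_rpow hs hN hΩf hq hqp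
  obtain ⟨S, hS, hsob⟩ := sobolev (N := N) hs hN
  set p := critExp N s with hpdef
  have hcrit : ∀ n, ∫ x, |f n x| ^ p ≤ S * (ρ ^ 2) ^ (p / 2) := fun n =>
    (hsob _ (hf n).memHs).2.trans (mul_le_mul_of_nonneg_left
      (Real.rpow_le_rpow (form_self_nonneg _ _) (hfρ n) (by positivity)) hS.le)
  have hK : ∀ n, ∫ x, f n x ^ 2 ≤ volume.real Ω + S * (ρ ^ 2) ^ (p / 2) := by
    intro n
    rw [(hf n).integral_sq_eq hΩm]
    have := (hf n).memHs.setIntegral_posPart_rpow_le hs hN hΩf (q := 2) two_pos hp2.le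
    simp only [max_eq_left (hf0 n _), Real.rpow_two] at this
    exact this.trans (add_le_add_right (hcrit n) _)
  obtain ⟨ns, g, hns, hgL, hae, hL2⟩ := exists_subseq_tendsto_L2 hs hΩm hΩf hf hK hfρ
  set h : ℕ → EuclideanSpace ℝ (Fin N) → ℝ := fun n => f (ns n) with hh
  -- The limit is nonnegative only a.e.; this representative is nonnegative everywhere.
  set u : EuclideanSpace ℝ (Fin N) → ℝ := fun x => max (g x) 0 with hu
  have hgu : ∀ᵐ x, g x = u x := by
    filter_upwards [hae] with x hx
    exact (max_eq_left (ge_of_tendsto' hx fun n => hf0 _ x)).symm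
  have hu0 : ∀ x, 0 ≤ u x := fun x => le_max_right _ _
  have haeu : ∀ᵐ x, Tendsto (fun n => h n x) atTop (𝓝 (u x)) := by
    filter_upwards [hae, hgu] with x h1 h2
    rwa [← h2]
  have huL : MemLp u 2 volume := hgL.ae_eq hgu
  have hL2u : Tendsto (fun n => ∫ x, (h n x - u x) ^ 2) atTop (𝓝 0) := by
    refine hL2.congr fun n => integral_congr_ae ?_
    filter_upwards [hgu] with x hx
    rw [hx]
  have huX : MemX0 s Ω u := memX0_of_tendsto (fun n => hf (ns n)) (fun n => hfρ (ns n)) huL haeu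
  have hform := tendsto_form_sub (fun n => hf (ns n)) (fun n => hfρ (ns n)) haeu
  have hcritlim := brezis_lieb (μ := volume.restrict Ω) (p := p) (by linarith) (f := h) (g := u)
    (K := S * (ρ ^ 2) ^ (p / 2)) (fun n => (hf (ns n)).memHs.memLp.1.restrict)
    (fun n => (hsob _ (hf (ns n)).memHs).1.integrableOn)
    (fun n => (setIntegral_le_integral (hsob _ (hf (ns n)).memHs).1
      (ae_of_all _ fun x => by positivity)).trans (hcrit (ns n))) (ae_restrict_of_ae haeu)
  simp only [hh, abs_of_nonneg (hf0 _ _), abs_of_nonneg (hu0 _)] at hcritlim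
  have hsing := tendsto_setIntegral_rpow (q := 1 - γ) h1γ (by linarith) hΩf
    (fun n => hf0 (ns n)) hu0 (fun n => hpos (hf0 _) (hf _) h1γ (by linarith))
    (hpos hu0 huX h1γ (by linarith)) (fun n => (hf (ns n)).memHs.memLp.sub huL) hL2u
  set B : ℕ → ℝ := fun n => form s (fun x => h n x - u x) (fun x => h n x - u x) with hB
  set c := form s u u with hc
  have hc0 : 0 ≤ c := form_self_nonneg s u
  have hBmem : ∀ n, B n ∈ Set.Icc 0 (2 * ρ ^ 2 + 2 * c) := fun n => by
    refine ⟨form_self_nonneg _ _, ?_⟩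
    have := (hf (ns n)).memHs.form_sub_self_le huX.memHs
    have := hfρ (ns n)
    simp only [hB, hh]
    linarith
  obtain ⟨b, hb, ms, hms, hblim⟩ := isCompact_Icc.tendsto_subseq hBmem
  have hb0 : 0 ≤ b := hb.1
  have hA : Tendsto (fun n => form s (h (ms n)) (h (ms n))) atTop (𝓝 (c + b)) := by
    have := (hform.comp hms.tendsto_atTop).add hblim
    refine this.congr fun n => ?_
    simp only [Function.comp_apply, hB, hh]
    ring
  have hcb : c + b ≤ ρ ^ 2 := le_of_tendsto' hA fun n => hfρ _
  refine ⟨u, huX, hu0, by linarith, ?_⟩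
  have hθ0 : 0 < θ := by linarith
  -- The critical integral is written as its Brezis-Lieb difference, which converges, plus the
  -- integral of `|w n|^p`, which `Geometry.critical_le` bounds by a power of `B`.
  have hstep : ∀ n, 1 / (2 * θ) * form s (h (ms n)) (h (ms n)) ^ θ
      - lam / (1 - γ) * (∫ x in Ω, h (ms n) x ^ (1 - γ))
      - 1 / p * ((∫ x in Ω, h (ms n) x ^ p) - ∫ x in Ω, |h (ms n) x - u x| ^ p)
      - 1 / (2 * θ) * (ρ ^ (2 * θ - p) * B (ms n) ^ (p / 2))
      ≤ energy s θ γ Ω lam (f (ns (ms n))) := fun n => by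
    rw [energy_eq_of_nonneg s θ γ Ω lam (hf0 _)]
    have := hgeo.critical_le hs hN hθ0 hγ₁ ((hf (ns (ms n))).sub huX)
    simp only [hh, hB, ← hpdef]
    rw [mul_sub]
    linarith
  have hlim := ((((hA.rpow_const (Or.inr hθ0.le)).const_mul (1 / (2 * θ))).sub
    ((hsing.comp hms.tendsto_atTop).const_mul (lam / (1 - γ)))).sub
    ((hcritlim.comp hms.tendsto_atTop).const_mul (1 / p))).sub
    (((hblim.rpow_const (p := p / 2) (Or.inr (by positivity))).const_mul
      (ρ ^ (2 * θ - p))).const_mul (1 / (2 * θ)))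
  have hfin := le_of_tendsto_of_tendsto' hlim
    (hm.comp (hns.tendsto_atTop.comp hms.tendsto_atTop)) hstep
  rw [energy_eq_of_nonneg s θ γ Ω lam hu0]
  refine le_trans ?_ hfin
  -- Since `b ≤ ρ²` and `p/2 > θ`, the excess power satisfies `b^(p/2-θ) ≤ ρ^(p-2θ)`.
  have h1 : ρ ^ (2 * θ - p) * b ^ (p / 2) ≤ b ^ θ := by
    have hbρ : b ≤ ρ ^ 2 := by linarith
    have e1 : b ^ (p / 2) = b ^ θ * b ^ (p / 2 - θ) := by
      rw [← Real.rpow_add_of_nonneg hb0 hθ0.le (by linarith)]; congr 1; ring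
    have e2 : b ^ (p / 2 - θ) ≤ ρ ^ (p - 2 * θ) := by
      refine (Real.rpow_le_rpow hb0 hbρ (by linarith)).trans_eq ?_
      rw [← Real.rpow_two, ← Real.rpow_mul hρ.le]; congr 1; ring
    have e3 : ρ ^ (2 * θ - p) * ρ ^ (p - 2 * θ) = 1 := by
      rw [← Real.rpow_add hρ]; simp
    calc ρ ^ (2 * θ - p) * b ^ (p / 2)
        = b ^ θ * (ρ ^ (2 * θ - p) * b ^ (p / 2 - θ)) := by rw [e1]; ring
      _ ≤ b ^ θ * (ρ ^ (2 * θ - p) * ρ ^ (p - 2 * θ)) := by gcongr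
      _ = b ^ θ := by rw [e3, mul_one]
  have h2 := Real.add_rpow_le_rpow_add hc0 hb0 hθ₁.le
  have h3 : 1 / (2 * θ) * (c ^ θ + ρ ^ (2 * θ - p) * b ^ (p / 2)) ≤ 1 / (2 * θ) * (c + b) ^ θ :=
    mul_le_mul_of_nonneg_left (by linarith) (by positivity)
  rw [mul_add] at h3
  linarith

theorem Geometry.exists_minimizer {θ γ ρ lam₀ α lam : ℝ} (hs : 0 < s) (hs₁ : s < 1)
    (hN : 2 * s < N) (hθ₁ : 1 < θ) (hθ₂ : θ < critExp N s / 2) (hγ₀ : 0 < γ) (hγ₁ : γ < 1)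
    (hΩo : IsOpen Ω) (hΩb : Bornology.IsBounded Ω) (hΩn : Ω.Nonempty)
    (hgeo : Geometry s θ γ Ω ρ lam₀ α) (hlam : 0 < lam) (hle : lam ≤ lam₀) :
    ∃ u, MemX0 s Ω u ∧ (∀ x, 0 ≤ u x) ∧ gnorm s u < ρ ∧ energy s θ γ Ω lam u < 0 ∧
      ∀ v, MemX0 s Ω v → gnorm s v ≤ ρ → energy s θ γ Ω lam u ≤ energy s θ γ Ω lam v := by
  have hΩf := hΩb.measure_lt_top (μ := volume).ne
  have hρ := hgeo.rho_pos
  have hp := critExp_pos hs hN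
  have hθ0 : 0 < θ := by linarith
  set E := {e | ∃ v, MemX0 s Ω v ∧ gnorm s v ≤ ρ ∧ energy s θ γ Ω lam v = e} with hE
  obtain ⟨v₀, hv₀, hv₀ρ, hv₀neg⟩ := exists_energy_neg hs hs₁ hN hθ₁ hγ₀ hγ₁ hΩo hΩb hΩn hlam hρ
  have hne : E.Nonempty := ⟨_, v₀, hv₀, hv₀ρ, rfl⟩
  obtain ⟨S, hS, hlow⟩ := energy_lower_bound (N := N) (Ω := Ω) hs hN hΩf hγ₀ hγ₁
  have h1γ : 0 < 1 - γ := by linarith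
  have hbdd : BddBelow E := by
    refine ⟨-(lam / (1 - γ) * (volume.real Ω + S * ρ ^ critExp N s))
      - 1 / critExp N s * (S * ρ ^ critExp N s), ?_⟩
    rintro e ⟨v, hv, hvρ, rfl⟩
    refine le_trans ?_ (hlow θ lam v hlam hv.memHs)
    have h1 : S * gnorm s v ^ critExp N s ≤ S * ρ ^ critExp N s := by
      have := gnorm_nonneg s v
      gcongr
    have h2 : lam / (1 - γ) * (volume.real Ω + S * gnorm s v ^ critExp N s)
        ≤ lam / (1 - γ) * (volume.real Ω + S * ρ ^ critExp N s) := by gcongr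
    have h3 : 1 / critExp N s * (S * gnorm s v ^ critExp N s)
        ≤ 1 / critExp N s * (S * ρ ^ critExp N s) := by gcongr
    have h4 : 0 ≤ 1 / (2 * θ) * gnorm s v ^ (2 * θ) := by
      have := gnorm_nonneg s v
      positivity
    linarith
  obtain ⟨e, -, helim, heE⟩ := exists_seq_tendsto_sInf hne hbdd
  choose v hv hvρ hve using heE
  have hinf : ∀ w, MemX0 s Ω w → gnorm s w ≤ ρ → sInf E ≤ energy s θ γ Ω lam w :=
    fun w hw hwρ => csInf_le hbdd ⟨w, hw, hwρ, rfl⟩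
  have hformle : ∀ n, form s (fun x => max (v n x) 0) (fun x => max (v n x) 0) ≤ ρ ^ 2 := by
    intro n
    refine ((hv n).memHs.form_comp_le lipschitzWith_max_zero (max_self 0)).trans ?_
    rw [← gnorm_sq]
    exact pow_le_pow_left₀ (gnorm_nonneg _ _) (hvρ n) 2
  have hm : Tendsto (fun n => energy s θ γ Ω lam (fun x => max (v n x) 0)) atTop
      (𝓝 (sInf E)) := by
    refine tendsto_of_tendsto_of_tendsto_of_le_of_le tendsto_const_nhds helim (fun n => ?_)
      fun n => ?_
    · refine hinf _ (hv n).posPart ?_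
      exact Real.sqrt_le_iff.2 ⟨hρ.le, hformle n⟩
    · rw [← hve n]
      exact energy_posPart_le hθ0 (hv n).memHs
  obtain ⟨u, hu, hu0, huρ, hum⟩ := hgeo.exists_energy_le_of_tendsto hs hN hθ₁ hθ₂ hγ₀ hγ₁
    hΩo.measurableSet hΩf (fun n => (hv n).posPart) (fun n x => le_max_right _ _) hformle hm
  have huρ' : gnorm s u ≤ ρ := Real.sqrt_le_iff.2 ⟨hρ.le, huρ⟩
  have hneg : energy s θ γ Ω lam u < 0 := (hum.trans (hinf v₀ hv₀ hv₀ρ)).trans_lt hv₀neg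
  -- On the sphere the energy would be at least `α > 0`, yet it is negative.
  refine ⟨u, hu, hu0, lt_of_le_of_ne huρ' fun h => ?_, hneg,
    fun w hw hwρ => hum.trans (hinf w hw hwρ)⟩
  have := hgeo.bound lam hlam hle u hu h
  linarith [hgeo.alpha_pos]

/-! ### The Euler-Lagrange equation -/

/-- Concavity, with the tangent taken at the larger point `b`: in the application `a = u x` may
vanish, where the slope is infinite. -/
theorem mul_rpow_sub_one_le_rpow_sub {a b q : ℝ} (ha : 0 ≤ a) (hab : a ≤ b) (hq0 : 0 < q)
    (hq1 : q ≤ 1) : q * ((b - a) * b ^ (q - 1)) ≤ b ^ q - a ^ q := by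
  rcases (ha.trans hab).eq_or_lt with h0 | hb
  · have : a = 0 := le_antisymm (h0 ▸ hab) ha
    rw [this, ← h0]; simp
  · have h1 : -1 ≤ a / b - 1 := by
      have : 0 ≤ a / b := by positivity
      linarith
    have h2 := rpow_one_add_le_one_add_mul_self h1 hq0.le hq1
    rw [add_sub_cancel, Real.div_rpow ha hb.le, div_le_iff₀ (by positivity)] at h2
    have h3 : b ^ (q - 1) = b ^ q / b := by rw [Real.rpow_sub_one hb.ne']
    rw [h3]
    have h4 : (1 + q * (a / b - 1)) * b ^ q = b ^ q - q * ((b - a) * (b ^ q / b)) := by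
      field_simp; ring
    linarith

/-- Convexity, with the tangent at the smaller point `a`. -/
theorem mul_rpow_sub_one_le_rpow_sub_of_one_lt {a b p : ℝ} (ha : 0 ≤ a) (hab : a ≤ b)
    (hp : 1 < p) : p * (a ^ (p - 1) * (b - a)) ≤ b ^ p - a ^ p := by
  rcases ha.eq_or_lt with h0 | ha
  · rw [← h0, Real.zero_rpow (by linarith), Real.zero_rpow (by linarith)]
    have : 0 ≤ b := h0 ▸ hab
    simp only [zero_mul, mul_zero, sub_zero]
    positivity
  · have hb := ha.trans_le hab
    have h1 : -1 ≤ b / a - 1 := by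
      have : 0 ≤ b / a := by positivity
      linarith
    have h2 := one_add_mul_self_le_rpow_one_add h1 hp.le
    rw [add_sub_cancel, Real.div_rpow hb.le ha.le, le_div_iff₀ (by positivity)] at h2
    have h3 : a ^ (p - 1) = a ^ p / a := by rw [Real.rpow_sub_one ha.ne']
    rw [h3]
    have h4 : (1 + p * (b / a - 1)) * a ^ p = a ^ p + p * (a ^ p / a * (b - a)) := by
      field_simp
    linarith

theorem MemX0.integrableOn_rpow (hs : 0 < s) (hN : 2 * s < N) (hΩf : volume Ω ≠ ⊤)
    (hu : MemX0 s Ω u) (hu0 : ∀ x, 0 ≤ u x) {q : ℝ} (hq : 0 < q) (hqp : q ≤ critExp N s) :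
    IntegrableOn (fun x => u x ^ q) Ω := by
  simpa only [max_eq_left (hu0 _)] using hu.memHs.integrableOn_posPart_rpow hs hN hΩf hq hqp

/-- `u` minimizes the energy over the closed ball of radius `ρ` of `X₀`, in its interior. -/
structure IsBallMinimizer (s θ γ : ℝ) (Ω : Set (EuclideanSpace ℝ (Fin N))) (lam ρ : ℝ)
    (u : EuclideanSpace ℝ (Fin N) → ℝ) : Prop where
  memX0 : MemX0 s Ω u
  nonneg : ∀ x, 0 ≤ u x
  gnorm_lt : gnorm s u < ρ
  energy_le : ∀ v, MemX0 s Ω v → gnorm s v ≤ ρ → energy s θ γ Ω lam u ≤ energy s θ γ Ω lam v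

variable {θ γ lam ρ : ℝ} {φ ψ : EuclideanSpace ℝ (Fin N) → ℝ}

/-- The form along the segment is a quadratic polynomial in `t`. As `θ > 1`, its power is
differentiable even if `form s u u = 0`. -/
theorem tendsto_kirchhoff_slope (hθ : 1 < θ) (hu : MemHs s u) (hφ : MemHs s φ) :
    Tendsto (fun t : ℝ => t⁻¹ * (1 / (2 * θ) *
        form s (fun x => u x + t * φ x) (fun x => u x + t * φ x) ^ θ
        - 1 / (2 * θ) * form s u u ^ θ)) (𝓝[>] 0)
      (𝓝 (form s u u ^ (θ - 1) * form s u φ)) := by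
  simp only [hu.form_add_mul_self hφ]
  set F := form s u u
  set b := form s u φ
  set c := form s φ φ
  have hq : HasDerivAt (fun t : ℝ => F + 2 * t * b + t ^ 2 * c) (2 * b) 0 := by
    have h1 := (((hasDerivAt_id (0 : ℝ)).const_mul 2).mul_const b).const_add F
    have h2 := ((hasDerivAt_id (0 : ℝ)).pow 2).mul_const c
    exact (h1.add h2).congr_deriv (by simp)
  have hd := (hq.rpow_const (p := θ) (Or.inr hθ.le)).const_mul (1 / (2 * θ))
  have hsl := (hasDerivAt_iff_tendsto_slope_zero.1 hd).mono_left
    (nhdsWithin_mono (0 : ℝ) (s := Set.Ioi 0) fun t ht => (Set.mem_Ioi.1 ht).ne')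
  simp only [zero_add, smul_eq_mul, mul_zero, zero_mul, add_zero, ne_eq, OfNat.ofNat_ne_zero,
    not_false_eq_true, zero_pow] at hsl
  convert hsl using 2
  field_simp

/-- Minimality at `u + tφ`, which stays in the ball for small `t`, divided by `t`. The tangent
inequalities bound the two difference quotients below, and these bounds also give integrability. The
denominator keeps `u + tφ` because `u > 0` is not yet known. -/
theorem IsBallMinimizer.eventually_le (hs : 0 < s) (hN : 2 * s < N) (hθ : 1 < θ) (hγ₀ : 0 < γ)
    (hγ₁ : γ < 1) (hΩf : volume Ω ≠ ⊤) (hlam : 0 < lam)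
    (hmin : IsBallMinimizer s θ γ Ω lam ρ u) (hφ : MemX0 s Ω φ) (hφ0 : ∀ x, 0 ≤ φ x)
    {C : ℝ} (hC : form s u u ^ (θ - 1) * form s u φ < C) :
    ∀ᶠ t in 𝓝[>] (0 : ℝ), IntegrableOn (fun x => φ x / (u x + t * φ x) ^ γ) Ω ∧
      IntegrableOn (fun x => u x ^ (critExp N s - 1) * φ x) Ω ∧
      lam * (∫ x in Ω, φ x / (u x + t * φ x) ^ γ)
        + ∫ x in Ω, u x ^ (critExp N s - 1) * φ x ≤ C := by
  have hp2 := two_lt_critExp hs hN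
  have hp := critExp_pos hs hN
  have hu := hmin.memX0
  have hu0 := hmin.nonneg
  have h1γ : 0 < 1 - γ := by linarith
  have hcont : Tendsto (fun t : ℝ => gnorm s (fun x => u x + t * φ x)) (𝓝[>] 0)
      (𝓝 (gnorm s u)) := by
    simp only [gnorm, hu.memHs.form_add_mul_self hφ.memHs]
    have h : Continuous (fun t : ℝ => √(form s u u + 2 * t * form s u φ + t ^ 2 * form s φ φ)) := by
      fun_prop
    have h2 := h.tendsto 0
    simp only [mul_zero, zero_mul, add_zero, ne_eq, OfNat.ofNat_ne_zero, not_false_eq_true,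
      zero_pow] at h2
    exact h2.mono_left nhdsWithin_le_nhds
  filter_upwards [self_mem_nhdsWithin, hcont.eventually (gt_mem_nhds hmin.gnorm_lt),
    (tendsto_kirchhoff_slope hθ hu.memHs hφ.memHs).eventually (gt_mem_nhds hC)] with t ht h1 h2
  have ht : 0 < t := ht
  have hv := hu.add_mul hφ t
  have hv0 : ∀ x, 0 ≤ u x + t * φ x := fun x => add_nonneg (hu0 x) (mul_nonneg ht.le (hφ0 x))
  have hle : ∀ x, u x ≤ u x + t * φ x := fun x => le_add_of_nonneg_right (mul_nonneg ht.le (hφ0 x))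
  have hE := hmin.energy_le _ hv h1.le
  rw [energy_eq_of_nonneg s θ γ Ω lam hu0, energy_eq_of_nonneg s θ γ Ω lam hv0] at hE
  have iu1 := hu.integrableOn_rpow hs hN hΩf hu0 (q := 1 - γ) h1γ (by linarith)
  have iv1 := hv.integrableOn_rpow hs hN hΩf hv0 (q := 1 - γ) h1γ (by linarith)
  have iu2 := hu.integrableOn_rpow hs hN hΩf hu0 hp le_rfl
  have iv2 := hv.integrableOn_rpow hs hN hΩf hv0 hp le_rfl
  have hb1 : ∀ x, φ x / (u x + t * φ x) ^ γ
      ≤ ((1 - γ) * t)⁻¹ * ((u x + t * φ x) ^ (1 - γ) - u x ^ (1 - γ)) := fun x => by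
    have h := mul_rpow_sub_one_le_rpow_sub (hu0 x) (hle x) h1γ (by linarith)
    rw [add_sub_cancel_left, show 1 - γ - 1 = -γ by ring, Real.rpow_neg (hv0 x)] at h
    rw [inv_mul_eq_div, le_div_iff₀ (by positivity)]
    refine le_trans (le_of_eq ?_) h
    rw [div_eq_mul_inv]; ring
  have hb2 : ∀ x, u x ^ (critExp N s - 1) * φ x
      ≤ (critExp N s * t)⁻¹ * ((u x + t * φ x) ^ critExp N s - u x ^ critExp N s) := fun x => by
    have h := mul_rpow_sub_one_le_rpow_sub_of_one_lt (hu0 x) (hle x) (p := critExp N s)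
      (by linarith)
    rw [add_sub_cancel_left] at h
    rw [inv_mul_eq_div, le_div_iff₀ (by positivity)]
    refine le_trans (le_of_eq ?_) h
    ring
  have hum : AEMeasurable u volume := hu.memHs.memLp.1.aemeasurable
  have hφm : AEMeasurable φ volume := hφ.memHs.memLp.1.aemeasurable
  have i1 : IntegrableOn (fun x => φ x / (u x + t * φ x) ^ γ) Ω := by
    refine ((iv1.sub iu1).const_mul ((1 - γ) * t)⁻¹).mono' ?_ (ae_of_all _ fun x => ?_)
    · exact (hφm.div ((hum.add (hφm.const_mul t)).pow_const γ)).aestronglyMeasurable.restrict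
    · rw [Real.norm_of_nonneg (div_nonneg (hφ0 x) (Real.rpow_nonneg (hv0 x) _))]
      exact hb1 x
  have i2 : IntegrableOn (fun x => u x ^ (critExp N s - 1) * φ x) Ω := by
    refine ((iv2.sub iu2).const_mul (critExp N s * t)⁻¹).mono' ?_ (ae_of_all _ fun x => ?_)
    · exact ((hum.pow_const _).mul hφm).aestronglyMeasurable.restrict
    · rw [Real.norm_of_nonneg (mul_nonneg (Real.rpow_nonneg (hu0 x) _) (hφ0 x))]
      exact hb2 x
  refine ⟨i1, i2, ?_⟩
  have e1 := setIntegral_mono i1 ((iv1.sub iu1).const_mul ((1 - γ) * t)⁻¹) hb1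
  have e2 := setIntegral_mono i2 ((iv2.sub iu2).const_mul (critExp N s * t)⁻¹) hb2
  simp only [Pi.sub_apply] at e1 e2
  rw [integral_const_mul, integral_sub iv1 iu1] at e1
  rw [integral_const_mul, integral_sub iv2 iu2] at e2
  have e3 := mul_le_mul_of_nonneg_left e1 hlam.le
  refine le_trans (add_le_add e3 e2) (le_trans ?_ h2.le)
  rw [← mul_le_mul_iff_right₀ ht]
  have k1 : ∀ A B : ℝ, t * (lam * (((1 - γ) * t)⁻¹ * A) + (critExp N s * t)⁻¹ * B)
      = lam / (1 - γ) * A + 1 / critExp N s * B := fun A B => by field_simp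
  rw [k1, mul_inv_cancel_left₀ ht.ne']
  linarith

theorem exists_seq_of_eventually_nhdsGT {P : ℝ → Prop} (h : ∀ᶠ t in 𝓝[>] (0 : ℝ), P t) :
    ∃ t : ℕ → ℝ, (∀ n, 0 < t n) ∧ (∀ n, P (t n)) ∧ Tendsto t atTop (𝓝 0) := by
  obtain ⟨t, ht, h2⟩ := exists_seq_forall_of_frequently (h.and self_mem_nhdsWithin).frequently
  exact ⟨t, fun n => (h2 n).2, fun n => (h2 n).1, ht.mono_right nhdsWithin_le_nhds⟩

/-- Where `u = 0` the integrand of `IsBallMinimizer.eventually_le` equals `t^(-γ) φ^(1-γ)`, while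
its integral stays below `C/λ`. Multiplying by `t^γ` and letting `t → 0` forces `φ^(1-γ)`, positive
in `Ω`, to have zero integral over `{u = 0}`. -/
theorem IsBallMinimizer.ae_pos (hs : 0 < s) (hs₁ : s < 1) (hN : 2 * s < N) (hθ : 1 < θ)
    (hγ₀ : 0 < γ) (hγ₁ : γ < 1) (hΩo : IsOpen Ω) (hΩb : Bornology.IsBounded Ω) (hlam : 0 < lam)
    (hmin : IsBallMinimizer s θ γ Ω lam ρ u) : ∀ᵐ x ∂(volume.restrict Ω), 0 < u x := by
  have hN0 : 0 < N := by
    have : (0 : ℝ) < N := by linarith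
    exact_mod_cast this
  have hΩf := hΩb.measure_lt_top (μ := volume).ne
  obtain ⟨φ, hφ, hφ0, hφpos⟩ := exists_memX0_pos hs hs₁ hN0 hΩo hΩb
  have hu0 := hmin.nonneg
  set C := max (form s u u ^ (θ - 1) * form s u φ + 1) 0 with hCdef
  have hC0 : 0 ≤ C := le_max_right _ _
  have hev := hmin.eventually_le hs hN hθ hγ₀ hγ₁ hΩf hlam hφ hφ0 (C := C)
    (lt_of_lt_of_le (lt_add_one _) (le_max_left _ _))
  set g : EuclideanSpace ℝ (Fin N) → ℝ := fun x => if u x = 0 then φ x ^ (1 - γ) else 0 with hg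
  have hbound : ∀ ε > 0, IntegrableOn g Ω ∧ ∫ x in Ω, g x ≤ ε := by
    intro ε hε
    have hl : Tendsto (fun t : ℝ => t ^ γ * (C / lam)) (𝓝[>] 0) (𝓝 0) := by
      have h1 : ContinuousAt (fun t : ℝ => t ^ γ * (C / lam)) 0 :=
        (Real.continuousAt_rpow_const 0 _ (Or.inr hγ₀.le)).mul_const _
      have h2 := h1.tendsto
      rw [Real.zero_rpow hγ₀.ne', zero_mul] at h2
      exact h2.mono_left nhdsWithin_le_nhds
    obtain ⟨t, ht0, htP, ht⟩ :=
      exists_seq_of_eventually_nhdsGT (hev.and (hl.eventually (gt_mem_nhds hε)))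
    refine integrable_and_integral_le_of_tendsto (f := fun n x =>
      t n ^ γ * (φ x / (u x + t n * φ x) ^ γ)) (fun n => (htP n).1.1.const_mul _)
      (fun n => ae_of_all _ fun x => ?_) (fun n => ?_) (ae_of_all _ fun x => ?_)
    · have := ht0 n
      have := hφ0 x
      have := hu0 x
      positivity
    · rw [integral_const_mul]
      refine le_trans (mul_le_mul_of_nonneg_left ?_ (Real.rpow_nonneg (ht0 n).le _)) (htP n).2.le
      rw [le_div_iff₀ hlam, mul_comm]
      have h1 := (htP n).1.2.2
      have h2 : 0 ≤ ∫ x in Ω, u x ^ (critExp N s - 1) * φ x :=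
        integral_nonneg fun x => mul_nonneg (Real.rpow_nonneg (hu0 x) _) (hφ0 x)
      linarith
    · by_cases hx : u x = 0
      · simp only [hg, hx, if_true, zero_add]
        refine tendsto_const_nhds.congr fun n => ?_
        rw [Real.mul_rpow (ht0 n).le (hφ0 x)]
        have htn : 0 < t n ^ γ := Real.rpow_pos_of_pos (ht0 n) _
        rcases (hφ0 x).eq_or_lt with h | h
        · rw [← h, Real.zero_rpow (by linarith)]; simp
        · rw [Real.rpow_sub h, Real.rpow_one]; field_simp
      · simp only [hg, hx, if_false]
        have hux : 0 < u x := lt_of_le_of_ne (hu0 x) (Ne.symm hx)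
        have h1 : Tendsto (fun n => u x + t n * φ x) atTop (𝓝 (u x)) := by
          simpa using (ht.mul_const (φ x)).const_add (u x)
        have h2 := (tendsto_const_nhds (x := φ x)).div
          (h1.rpow_const (p := γ) (Or.inl hx)) (Real.rpow_pos_of_pos hux _).ne'
        have h3 := (ht.rpow_const (p := γ) (Or.inr hγ₀.le)).mul h2
        simpa [Real.zero_rpow hγ₀.ne'] using h3
  have hgi := (hbound 1 one_pos).1
  have hg0 : ∀ x, 0 ≤ g x := fun x => by
    simp only [hg]; split_ifs
    · exact Real.rpow_nonneg (hφ0 x) _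
    · exact le_rfl
  have hz : ∫ x in Ω, g x = 0 :=
    le_antisymm (le_of_forall_pos_le_add fun ε hε => by simpa using (hbound ε hε).2)
      (integral_nonneg hg0)
  have hae := (integral_eq_zero_iff_of_nonneg hg0 hgi).1 hz
  filter_upwards [hae, ae_restrict_mem hΩo.measurableSet] with x hx hxΩ
  refine lt_of_le_of_ne (hu0 x) fun h => ?_
  have : g x = φ x ^ (1 - γ) := if_pos h.symm
  rw [this] at hx
  exact (Real.rpow_pos_of_pos (hφpos x hxΩ) _).ne' hx

/-- Fatou's lemma as `t → 0` in `IsBallMinimizer.eventually_le`; positivity of `u` gives the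
pointwise limit, and the slack `C` is removed last. -/
theorem IsBallMinimizer.supersolution (hs : 0 < s) (hN : 2 * s < N) (hθ : 1 < θ) (hγ₀ : 0 < γ)
    (hγ₁ : γ < 1) (hΩf : volume Ω ≠ ⊤) (hlam : 0 < lam)
    (hmin : IsBallMinimizer s θ γ Ω lam ρ u) (hpos : ∀ᵐ x ∂(volume.restrict Ω), 0 < u x)
    (hφ : MemX0 s Ω φ) (hφ0 : ∀ x, 0 ≤ φ x) :
    IntegrableOn (fun x => φ x / u x ^ γ) Ω ∧
      IntegrableOn (fun x => u x ^ (critExp N s - 1) * φ x) Ω ∧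
      lam * (∫ x in Ω, φ x / u x ^ γ) + ∫ x in Ω, u x ^ (critExp N s - 1) * φ x
        ≤ form s u u ^ (θ - 1) * form s u φ := by
  have hu0 := hmin.nonneg
  have key : ∀ C, form s u u ^ (θ - 1) * form s u φ < C →
      IntegrableOn (fun x => φ x / u x ^ γ) Ω ∧
      IntegrableOn (fun x => u x ^ (critExp N s - 1) * φ x) Ω ∧
      lam * (∫ x in Ω, φ x / u x ^ γ) + ∫ x in Ω, u x ^ (critExp N s - 1) * φ x ≤ C := by
    intro C hC
    obtain ⟨t, ht0, htP, ht⟩ := exists_seq_of_eventually_nhdsGT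
      (hmin.eventually_le hs hN hθ hγ₀ hγ₁ hΩf hlam hφ hφ0 hC)
    have h := integrable_and_integral_le_of_tendsto (μ := volume.restrict Ω)
      (f := fun n x => φ x / (u x + t n * φ x) ^ γ) (g := fun x => φ x / u x ^ γ)
      (C := (C - ∫ x in Ω, u x ^ (critExp N s - 1) * φ x) / lam) (fun n => (htP n).1)
      (fun n => ae_of_all _ fun x => by
        have := (ht0 n).le
        have := hφ0 x
        have := hu0 x
        positivity)
      (fun n => by
        rw [le_div_iff₀ hlam]
        linarith [(htP n).2.2])
      (by
        filter_upwards [hpos] with x hx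
        have h1 : Tendsto (fun n => u x + t n * φ x) atTop (𝓝 (u x)) := by
          simpa using (ht.mul_const (φ x)).const_add (u x)
        exact tendsto_const_nhds.div (h1.rpow_const (p := γ) (Or.inl hx.ne'))
          (Real.rpow_pos_of_pos hx _).ne')
    refine ⟨h.1, (htP 0).2.1, ?_⟩
    have h2 := h.2
    rw [le_div_iff₀ hlam] at h2
    linarith
  have h1 := key _ (lt_add_one _)
  exact ⟨h1.1, h1.2.1, le_of_forall_pos_le_add fun ε hε => (key _ (lt_add_of_pos_right _ hε)).2.2⟩

/-- As `u` is interior, `tu` is admissible for `t` on both sides of 1, and the energy along this ray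
is differentiable, so its derivative vanishes at `t = 1`. -/
theorem IsBallMinimizer.self_test (hs : 0 < s) (hN : 2 * s < N) (hθ : 1 < θ)
    (hγ₁ : γ < 1) (hmin : IsBallMinimizer s θ γ Ω lam ρ u) :
    lam * (∫ x in Ω, u x / u x ^ γ) + ∫ x in Ω, u x ^ (critExp N s - 1) * u x
      = form s u u ^ (θ - 1) * form s u u := by
  have hp2 := two_lt_critExp hs hN
  have hu0 := hmin.nonneg
  have h1γ : 0 < 1 - γ := by linarith
  have e1 : ∀ x, u x / u x ^ γ = u x ^ (1 - γ) := fun x => by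
    rcases (hu0 x).eq_or_lt with h | h
    · rw [← h, Real.zero_rpow h1γ.ne']; simp
    · rw [Real.rpow_sub h, Real.rpow_one]
  have e2 : ∀ x, u x ^ (critExp N s - 1) * u x = u x ^ critExp N s := fun x => by
    have := Real.rpow_add_of_nonneg (hu0 x) (by linarith : 0 ≤ critExp N s - 1) zero_le_one
    rw [sub_add_cancel, Real.rpow_one] at this
    exact this.symm
  have e3 : form s u u ^ (θ - 1) * form s u u = form s u u ^ θ := by
    have := Real.rpow_add_of_nonneg (form_self_nonneg s u) (by linarith : 0 ≤ θ - 1) zero_le_one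
    rw [sub_add_cancel, Real.rpow_one] at this
    exact this.symm
  simp only [e1, e2, e3]
  set F := form s u u ^ θ
  set S := ∫ x in Ω, u x ^ (1 - γ)
  set P := ∫ x in Ω, u x ^ critExp N s
  set p := critExp N s
  have hpow : ∀ r : ℝ, HasDerivAt (fun t : ℝ => t ^ r) r 1 := fun r => by
    have := Real.hasDerivAt_rpow_const (x := 1) (p := r) (Or.inl one_ne_zero)
    simpa using this
  have hd : HasDerivAt (fun t : ℝ => 1 / (2 * θ) * (t ^ (2 * θ) * F)
      - lam / (1 - γ) * (t ^ (1 - γ) * S) - 1 / p * (t ^ p * P))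
      (1 / (2 * θ) * (2 * θ * F) - lam / (1 - γ) * ((1 - γ) * S) - 1 / p * (p * P)) 1 :=
    ((((hpow _).mul_const F).const_mul _).sub (((hpow _).mul_const S).const_mul _)).sub
      (((hpow _).mul_const P).const_mul _)
  have hcont : Tendsto (fun t : ℝ => t * gnorm s u) (𝓝 1) (𝓝 (gnorm s u)) := by
    have h : Continuous (fun t : ℝ => t * gnorm s u) := by fun_prop
    simpa using h.tendsto 1
  have hloc : IsLocalMin (fun t : ℝ => 1 / (2 * θ) * (t ^ (2 * θ) * F)
      - lam / (1 - γ) * (t ^ (1 - γ) * S) - 1 / p * (t ^ p * P)) 1 := by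
    filter_upwards [hcont.eventually (gt_mem_nhds hmin.gnorm_lt), lt_mem_nhds one_pos]
      with t ht ht0
    have := hmin.energy_le _ (hmin.memX0.const_mul t)
      (by rw [gnorm_const_mul s ht0.le]; exact ht.le)
    rw [energy_const_mul s θ γ Ω lam ht0 hu0, energy_eq_of_nonneg s θ γ Ω lam hu0] at this
    simpa using this
  have h0 := hloc.hasDerivAt_eq_zero hd
  have hθ0 : 0 < θ := by linarith
  have hp0 : 0 < p := by linarith
  field_simp at h0
  linarith

/-- The defect of the weak formulation at the test function `φ`. -/
def residual (s θ γ : ℝ) (Ω : Set (EuclideanSpace ℝ (Fin N))) (lam : ℝ)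
    (u φ : EuclideanSpace ℝ (Fin N) → ℝ) : ℝ :=
  form s u u ^ (θ - 1) * form s u φ - (lam * (∫ x in Ω, φ x / u x ^ γ)
    + ∫ x in Ω, u x ^ (critExp N s - 1) * φ x)

theorem residual_comb (hu : MemHs s u) (hφ : MemHs s φ) (hψ : MemHs s ψ)
    (iφ₁ : IntegrableOn (fun x => φ x / u x ^ γ) Ω)
    (iφ₂ : IntegrableOn (fun x => u x ^ (critExp N s - 1) * φ x) Ω)
    (iψ₁ : IntegrableOn (fun x => ψ x / u x ^ γ) Ω)
    (iψ₂ : IntegrableOn (fun x => u x ^ (critExp N s - 1) * ψ x) Ω) (a b : ℝ) :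
    residual s θ γ Ω lam u (fun x => a * φ x + b * ψ x)
      = a * residual s θ γ Ω lam u φ + b * residual s θ γ Ω lam u ψ := by
  have e1 : ∫ x in Ω, (a * φ x + b * ψ x) / u x ^ γ
      = a * (∫ x in Ω, φ x / u x ^ γ) + b * ∫ x in Ω, ψ x / u x ^ γ := by
    rw [← integral_const_mul, ← integral_const_mul,
      ← integral_add (iφ₁.const_mul a) (iψ₁.const_mul b)]
    congr 1; funext x; ring
  have e2 : ∫ x in Ω, u x ^ (critExp N s - 1) * (a * φ x + b * ψ x)
      = a * (∫ x in Ω, u x ^ (critExp N s - 1) * φ x)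
        + b * ∫ x in Ω, u x ^ (critExp N s - 1) * ψ x := by
    rw [← integral_const_mul, ← integral_const_mul,
      ← integral_add (iφ₂.const_mul a) (iψ₂.const_mul b)]
    congr 1; funext x; ring
  rw [residual, e1, e2, hu.form_comb hφ hψ, residual, residual]
  ring

/-- With `ψ = (φ - ku)⁺` the function `ku - φ + ψ` is nonnegative. As the residual vanishes at `u`,
that of `φ` is at most that of `ψ`, hence at most `A ⟨u, ψ⟩`, which is `O(1/k)`. -/
theorem IsBallMinimizer.residual_eq_zero (hs : 0 < s) (hN : 2 * s < N) (hθ : 1 < θ) (hγ₀ : 0 < γ)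
    (hγ₁ : γ < 1) (hΩf : volume Ω ≠ ⊤) (hlam : 0 < lam)
    (hmin : IsBallMinimizer s θ γ Ω lam ρ u) (hpos : ∀ᵐ x ∂(volume.restrict Ω), 0 < u x)
    (hφ : MemX0 s Ω φ) (hφ0 : ∀ x, 0 ≤ φ x) : residual s θ γ Ω lam u φ = 0 := by
  have hsup : ∀ ψ : EuclideanSpace ℝ (Fin N) → ℝ, MemX0 s Ω ψ → (∀ x, 0 ≤ ψ x) → _ :=
    fun ψ hψ hψ0 => hmin.supersolution hs hN hθ hγ₀ hγ₁ hΩf hlam hpos hψ hψ0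
  have hnn : ∀ ψ : EuclideanSpace ℝ (Fin N) → ℝ, MemX0 s Ω ψ → (∀ x, 0 ≤ ψ x) →
      0 ≤ residual s θ γ Ω lam u ψ := fun ψ hψ hψ0 => sub_nonneg.2 (hsup ψ hψ hψ0).2.2
  have hu := hmin.memX0
  have hu0 := hmin.nonneg
  refine le_antisymm ?_ (hnn φ hφ hφ0)
  have hself : residual s θ γ Ω lam u u = 0 := by
    rw [residual, hmin.self_test hs hN hθ hγ₁, sub_self]
  set A := form s u u ^ (θ - 1) with hA
  have hA0 : 0 ≤ A := Real.rpow_nonneg (form_self_nonneg s u) _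
  have hk : ∀ k : ℝ, 0 < k → residual s θ γ Ω lam u φ ≤ A * (form s φ φ / 4) / k := by
    intro k hk
    have hv := hφ.add_mul hu (-k)
    have hψ := hv.posPart
    have hψ0 : ∀ x, 0 ≤ max (φ x + -k * u x) 0 := fun x => le_max_right _ _
    have hform := hv.memHs.form_posPart_le
    have hform2 := hφ.memHs.form_le hψ.memHs
    set ψ : EuclideanSpace ℝ (Fin N) → ℝ := fun x => max (φ x + -k * u x) 0 with hψdef
    have e1 : form s (fun x => φ x + -k * u x) ψ = form s φ ψ - k * form s u ψ := by
      have := hψ.memHs.form_comb hφ.memHs hu.memHs 1 (-k)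
      simp only [one_mul] at this
      rw [form_comm, this, form_comm s ψ φ, form_comm s ψ u]; ring
    rw [e1] at hform
    -- From `⟨ψ, ψ⟩ ≤ ⟨φ - ku, ψ⟩ ≤ ⟨φ, φ⟩/4 + ⟨ψ, ψ⟩ - k⟨u, ψ⟩`, where `⟨ψ, ψ⟩` cancels.
    have h1 : form s u ψ ≤ form s φ φ / 4 / k := by
      rw [le_div_iff₀ hk]; linarith
    obtain ⟨iψ₁, iψ₂, -⟩ := hsup ψ hψ hψ0
    obtain ⟨iφ₁, iφ₂, -⟩ := hsup φ hφ hφ0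
    obtain ⟨iu₁, iu₂, -⟩ := hsup u hu hu0
    have hχ := (hu.comb hφ k (-1)).add_mul hψ 1
    have hχ0 : ∀ x, 0 ≤ k * u x + -1 * φ x + 1 * ψ x := fun x => by
      have := le_max_left (φ x + -k * u x) 0
      simp only [hψdef]; linarith
    have hres := hnn _ hχ hχ0
    have e2 := residual_comb (θ := θ) (lam := lam) hu.memHs hu.memHs hφ.memHs iu₁ iu₂ iφ₁ iφ₂
      k (-1)
    have j₁ : IntegrableOn (fun x => (k * u x + -1 * φ x) / u x ^ γ) Ω := by
      refine ((iu₁.const_mul k).add (iφ₁.const_mul (-1))).congr (ae_of_all _ fun x => ?_)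
      simp only [Pi.add_apply]; ring
    have j₂ : IntegrableOn (fun x => u x ^ (critExp N s - 1) * (k * u x + -1 * φ x)) Ω := by
      refine ((iu₂.const_mul k).add (iφ₂.const_mul (-1))).congr (ae_of_all _ fun x => ?_)
      simp only [Pi.add_apply]; ring
    have e3 := residual_comb (θ := θ) (lam := lam) hu.memHs (hu.comb hφ k (-1)).memHs hψ.memHs
      j₁ j₂ iψ₁ iψ₂ 1 1
    simp only [one_mul] at e3 hres
    rw [e3, e2, hself] at hres
    have h2 : residual s θ γ Ω lam u ψ ≤ A * form s u ψ := by
      have a1 : 0 ≤ ∫ x in Ω, ψ x / u x ^ γ :=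
        integral_nonneg fun x => div_nonneg (hψ0 x) (Real.rpow_nonneg (hu0 x) _)
      have a2 : 0 ≤ ∫ x in Ω, u x ^ (critExp N s - 1) * ψ x :=
        integral_nonneg fun x => mul_nonneg (Real.rpow_nonneg (hu0 x) _) (hψ0 x)
      have a3 := mul_nonneg hlam.le a1
      rw [residual, ← hA]; linarith
    have h3 := mul_le_mul_of_nonneg_left h1 hA0
    have h4 : A * (form s φ φ / 4) / k = A * (form s φ φ / 4 / k) := by ring
    rw [h4]; linarith
  have hlim : Tendsto (fun k : ℝ => A * (form s φ φ / 4) / k) atTop (𝓝 0) :=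
    tendsto_const_nhds.div_atTop tendsto_id
  exact ge_of_tendsto hlim ((eventually_gt_atTop 0).mono fun k hk0 => hk k hk0)

theorem IsBallMinimizer.isSolution (hs : 0 < s) (hs₁ : s < 1) (hN : 2 * s < N) (hθ : 1 < θ)
    (hγ₀ : 0 < γ) (hγ₁ : γ < 1) (hΩo : IsOpen Ω) (hΩb : Bornology.IsBounded Ω) (hlam : 0 < lam)
    (hmin : IsBallMinimizer s θ γ Ω lam ρ u) : IsSolution s θ γ Ω lam u := by
  have hΩf := hΩb.measure_lt_top (μ := volume).ne
  have hpos := hmin.ae_pos hs hs₁ hN hθ hγ₀ hγ₁ hΩo hΩb hlam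
  have hu0 := hmin.nonneg
  have hdec : ∀ φ, MemX0 s Ω φ → IntegrableOn (fun x => φ x / u x ^ γ) Ω ∧
      IntegrableOn (fun x => u x ^ (critExp N s - 1) * φ x) Ω ∧
      residual s θ γ Ω lam u φ = 0 := by
    intro φ hφ
    have hφ' : MemX0 s Ω (fun x => max (-1 * φ x) 0) := (hφ.const_mul (-1)).posPart
    -- Arbitrary test functions are handled as `φ⁺ - φ⁻`, both parts lying in `X₀`.
    have hsplit : φ = fun x => 1 * max (φ x) 0 + -1 * max (-1 * φ x) 0 := by
      funext x
      rcases le_total 0 (φ x) with h | h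
      · rw [max_eq_left h, max_eq_right (by linarith)]; ring
      · rw [max_eq_right h, max_eq_left (by linarith)]; ring
    obtain ⟨p₁, p₂, -⟩ := hmin.supersolution hs hN hθ hγ₀ hγ₁ hΩf hlam hpos hφ.posPart
      fun x => le_max_right _ _
    obtain ⟨n₁, n₂, -⟩ := hmin.supersolution hs hN hθ hγ₀ hγ₁ hΩf hlam hpos hφ'
      fun x => le_max_right _ _
    have rp := hmin.residual_eq_zero hs hN hθ hγ₀ hγ₁ hΩf hlam hpos hφ.posPart
      fun x => le_max_right _ _
    have rn := hmin.residual_eq_zero hs hN hθ hγ₀ hγ₁ hΩf hlam hpos hφ'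
      fun x => le_max_right _ _
    rw [hsplit]
    refine ⟨?_, ?_, ?_⟩
    · refine ((p₁.const_mul 1).add (n₁.const_mul (-1))).congr (ae_of_all _ fun x => ?_)
      simp only [Pi.add_apply]; ring
    · refine ((p₂.const_mul 1).add (n₂.const_mul (-1))).congr (ae_of_all _ fun x => ?_)
      simp only [Pi.add_apply]; ring
    · rw [residual_comb hmin.memX0.memHs hφ.posPart.memHs hφ'.memHs p₁ p₂ n₁ n₂, rp, rn]
      ring
  refine ⟨hmin.memX0, hpos, fun φ hφ => ?_, fun φ hφ => ?_, fun φ hφ => ?_⟩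
  · simpa only [max_eq_left (hu0 _)] using (hdec φ hφ).1
  · simpa only [max_eq_left (hu0 _)] using (hdec φ hφ).2.1
  · simp only [max_eq_left (hu0 _), gnorm_rpow]
    exact sub_eq_zero.1 (hdec φ hφ).2.2

end FracKirchhoff

end

theorem theorem3p2 (N : ℕ) (s θ γ : ℝ) (hs₀ : 0 < s) (hs₁ : s < 1) (hN : 2 * s < (N : ℝ))
    (hθ₁ : 1 < θ) (hθ₂ : θ < FracKirchhoff.critExp N s / 2) (hγ₀ : 0 < γ) (hγ₁ : γ < 1)
    (Ω : Set (EuclideanSpace ℝ (Fin N))) (hΩo : IsOpen Ω) (hΩb : Bornology.IsBounded Ω)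
    (hΩn : Ω.Nonempty) :
    (∃ ρ lam₀ α : ℝ, FracKirchhoff.Geometry s θ γ Ω ρ lam₀ α) ∧
    ∀ ρ lam₀ α : ℝ, FracKirchhoff.Geometry s θ γ Ω ρ lam₀ α →
      ∀ lam : ℝ, 0 < lam → lam ≤ lam₀ →
        ∃ u₀ : EuclideanSpace ℝ (Fin N) → ℝ,
          FracKirchhoff.IsSolution s θ γ Ω lam u₀ ∧
            FracKirchhoff.energy s θ γ Ω lam u₀ < 0 := by
  refine ⟨FracKirchhoff.exists_geometry hs₀ hN hΩb.measure_lt_top.ne hθ₁ hθ₂ hγ₀ hγ₁,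
    fun ρ lam₀ α hgeo lam hlam hle => ?_⟩
  obtain ⟨u, hu, hu0, huρ, hneg, hmin⟩ :=
    hgeo.exists_minimizer hs₀ hs₁ hN hθ₁ hθ₂ hγ₀ hγ₁ hΩo hΩb hΩn hlam hle
  exact ⟨u, FracKirchhoff.IsBallMinimizer.isSolution hs₀ hs₁ hN hθ₁ hγ₀ hγ₁ hΩo hΩb hlam
    ⟨hu, hu0, huρ, hmin⟩, hneg⟩
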